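/- For $n\in\mathbb N$ let $V_n=\{0,1\}^n$, let $E_n=\{(v,v+e_j): v,v+e_j\in V_n,\ j\le n\}$ be the set of oriented edges of the $n$-dimensional hypercube, let $d$ be the Hamming distance, and let $(\xi_e)_{e\in E_n}$ be independent standard exponential random variables. Let $\Sigma_n$ be the set of oriented paths $\pi=(\pi_1,\dots,\pi_{n+1})\in V_n^{n+1}$ with $\pi_1=\boldsymbol 0=(0,\dots,0)$, $\pi_{n+1}=\boldsymbol 1=(1,\dots,1)$ and $(\pi_i,\pi_{i+1})\in E_n$ for all $i\le n$. Put $X_\pi=\sum_{i\le n}\xi_{(\pi_i,\pi_{i+1})}$ and, for $A\subset\mathbb R$, $I_\pi(A)=\delta_{n(X_\pi-1)}(A)$. For $r\in\mathbb N$ let $$\mathcal F_{r,n}=\sigma\big(\xi_e:\ e=(u,v)\in E_n,\ \min\{d(u,\boldsymbol 0),d(v,\boldsymbol 0)\}\in[0,r)\cup[n-r,n)\big),\qquad \lambda_{r,n}(A)=\sum_{\pi\in\Sigma_n}\mathbb E\big[I_\pi(A)\,\big|\,\mathcal F_{r,n}\big].$$ Let $Z$ be distributed like the product of two independent standard exponentials,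 and let $A$ be a finite union of intervals, each of them bounded above (for instance $A=(-\infty,a]$ with $a\in\mathbb R$, or a finite union of bounded intervals). Then $$\lim_{r\to\infty}\,\lim_{n\to\infty}\lambda_{r,n}(A)=Z\int_A e^{x-1}\,dx\qquad\text{weakly},$$ that is: for every fixed $r$ the law of $\lambda_{r,n}(A)$ converges weakly, as $n\to\infty$, to a probability measure $\nu_r$ on $\mathbb R$, and $\nu_r$ converges weakly, as $r\to\infty$, to the law of $Z\int_A e^{x-1}\,dx$. -/

import Mathlib

open MeasureTheory ProbabilityTheory Filter

namespace HypercubeFPP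

/-- The vertices `{0,1}ⁿ` of the `n`-dimensional hypercube (`false` is `0`, `true` is `1`). -/
abbrev Vertex (n : ℕ) : Type := Fin n → Bool

/-- The vertex `(0, …, 0)`. -/
def origin (n : ℕ) : Vertex n := fun _ => false

/-- The vertex `(1, …, 1)`. -/
def target (n : ℕ) : Vertex n := fun _ => true

/-- `(u, v)` is an oriented edge: `v = u + e_j` for some coordinate `j`, which means that the
`j`-th coordinate is switched from `0` to `1` and the others are kept. -/
def IsEdge {n : ℕ} (u v : Vertex n) : Prop :=
  ∃ j : Fin n, u j = false ∧ v = Function.update u j true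

instance {n : ℕ} (u v : Vertex n) : Decidable (IsEdge u v) :=
  inferInstanceAs (Decidable (∃ j : Fin n, u j = false ∧ v = Function.update u j true))

/-- The oriented edges of the `n`-dimensional hypercube. -/
abbrev Edge (n : ℕ) : Type := {e : Vertex n × Vertex n // IsEdge e.1 e.2}

/-- The oriented paths `(π_1, …, π_{n+1})` from `(0, …, 0)` to `(1, …, 1)`
(indexed here by `0, …, n`). -/
abbrev OrientedPath (n : ℕ) : Type :=
  {p : Fin (n + 1) → Vertex n //
    p 0 = origin n ∧ p (Fin.last n) = target n ∧ ∀ i : Fin n, IsEdge (p i.castSucc) (p i.succ)}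

/-- The successive edges of an oriented path. -/
def OrientedPath.edge {n : ℕ} (p : OrientedPath n) (i : Fin n) : Edge n :=
  ⟨(p.1 i.castSucc, p.1 i.succ), p.2.2.2 i⟩

/-- The smaller one of the distances of the two endpoints of an edge from the origin. -/
def Edge.level {n : ℕ} (e : Edge n) : ℕ :=
  min (hammingDist e.1.1 (origin n)) (hammingDist e.1.2 (origin n))

/-- The edges whose level lies in `[0, r) ∪ [n - r, n)`. -/
def Edge.IsOuter {n : ℕ} (r : ℕ) (e : Edge n) : Prop :=
  e.level < r ∨ ((n : ℤ) - r ≤ e.level ∧ e.level < n)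

section Weights

variable {n : ℕ} {Ω : Type*}

/-- The weight `X_π` of a path: the sum of the weights of its edges. -/
def pathWeight (ξ : Edge n → Ω → ℝ) (p : OrientedPath n) (ω : Ω) : ℝ :=
  ∑ i : Fin n, ξ (OrientedPath.edge p i) ω

/-- `I_π(A) = δ_{n (X_π - 1)}(A)`: one if `n (X_π - 1) ∈ A`, and zero otherwise. -/
noncomputable def pathIndicator (ξ : Edge n → Ω → ℝ) (A : Set ℝ) (p : OrientedPath n) (ω : Ω) : ℝ :=
  A.indicator (fun _ => (1 : ℝ)) ((n : ℝ) * (pathWeight ξ p ω - 1))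

/-- The sigma-algebra `F_{r,n}` generated by the weights of the outer edges. -/
@[reducible] def outerSigma (ξ : Edge n → Ω → ℝ) (r : ℕ) : MeasurableSpace Ω :=
  MeasurableSpace.comap (fun ω (e : {e : Edge n // Edge.IsOuter r e}) => ξ e.1 ω) inferInstance

/-- The random Poisson parameter `λ_{r,n}(A) = ∑_π E[I_π(A) | F_{r,n}]`. -/
noncomputable def poissonParameter [MeasurableSpace Ω] (P : Measure Ω) (ξ : Edge n → Ω → ℝ)
    (r : ℕ) (A : Set ℝ) (ω : Ω) : ℝ :=
  ∑ p : OrientedPath n, (P[pathIndicator ξ A p | outerSigma ξ r]) ω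

end Weights

/-- The law of the product of two independent standard exponential random variables. -/
noncomputable def expProductLaw : Measure ℝ :=
  ((expMeasure 1).prod (expMeasure 1)).map (fun q : ℝ × ℝ => q.1 * q.2)

end HypercubeFPP

namespace HypercubeFPP

/-! ### The limiting branching recursion, on the level of characteristic functions. -/

section CharacteristicFunctions

open Set Topology

/-! Fix `r` and write `c = ∫_A e^{x-1} dx`. Given the outer weights, a path with outer sum `s` hits
the window with a probability that depends on `s` only, since its `n - 2r` inner weights add up to a
Gamma variable. Rescaling the Gamma density near `1` shows that this probability times `(n - 2r)!`
is close to `c e^{-ns}`, with an error that still decays exponentially in `ns`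
(`abs_factorial_mul_gammaHit_sub_le`). So every outer edge contributes a Boltzmann factor
`e^{-nξ_e}`, and `λ_{r,n}(A)` is close in `L¹` to `c / (n - 2r)!` times the total Boltzmann weight
of the outer parts of all paths.

An initial piece ending in `u` and a final piece starting in `v` are joined by `(n - 2r)!` inner
paths if `u ≤ v`, and by none otherwise. The pairs without a connection carry a negligible mean
weight (`integral_abs_sub_outerPathMass_le`), so `λ_{r,n}(A)` is close to `c W W'`, where `W` and
`W'` are the Boltzmann weights of all paths of length `r` out of `0` and into `1`. For `2r ≤ n` they
depend on disjoint sets of edges, and reversal of the cube exchanges them, so they are independent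
with the same law (`map_totalMass_mul_totalBackwardMass`).

It remains to find the limit of `W`. A vertex of bounded height has about `n` outgoing edges, the
values `nξ_e` on them look like a Poisson process of rate one on the half-line, and different paths
rarely merge. Hence `W` converges to the mass of generation `r` of a branching structure in which a
child at the Poisson point `s` inherits its parent's mass times `e^{-s}`. The characteristic
functions satisfy `φ_0(x) = e^{ix}` and `φ_{r+1}(x) = exp(-∫_0^∞ (1 - φ_r(x e^{-s})) ds)`; the error
at finite `n` is `O(1/n)` (`exists_norm_integral_massCharFun_sub_le`).

The characteristic function `1/(1 - ix)` of the standard exponential is a fixed point of this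
recursion. It agrees with `e^{ix}` to first order, so the two differ by at most `2x²`, and each step
of the recursion halves the constant because `∫_0^∞ e^{-2s} ds = 1/2`
(`norm_massCharFun_sub_expCharFun_le`). Thus the generation masses converge to a standard
exponential as `r → ∞`, and `c W W'` to `c Z`. -/

lemma norm_exp_neg_sub_exp_neg_le {a b : ℂ} (ha : 0 ≤ a.re) (hb : 0 ≤ b.re) :
    ‖Complex.exp (-a) - Complex.exp (-b)‖ ≤ ‖a - b‖ := by
  have h := Convex.norm_image_sub_le_of_norm_deriv_le (𝕜 := ℂ) (f := Complex.exp)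
    (s := {z : ℂ | z.re ≤ 0}) (x := -b) (y := -a) (C := 1)
    (fun x _ => Complex.differentiableAt_exp) (fun x hx => by
      rw [Complex.deriv_exp, Complex.norm_exp]
      exact Real.exp_le_one_iff.2 hx) (convex_halfSpace_re_le 0) (by simpa using hb)
      (by simpa using ha)
  rw [one_mul] at h
  refine h.trans_eq ?_
  rw [← norm_neg]
  congr 1
  ring

/-- Functions which, like `x ↦ E exp (i x W)` for suitable random variables `W ≥ 0` of mean one,
are close to `1` at the origin and almost multiplicative. -/
structure IsNearlyMultiplicative (g : ℝ → ℂ) : Prop where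
  norm_le_one : ∀ x, ‖g x‖ ≤ 1
  norm_one_sub_le : ∀ x, ‖1 - g x‖ ≤ |x|
  norm_sub_mul_le : ∀ x y, ‖g (x + y) - g x * g y‖ ≤ |x| * |y|

/-- The Laplace exponent `∫_0^∞ (1 - g (x e^{-s})) ds` of a Poisson process of rate one. -/
noncomputable def poissonExponent (g : ℝ → ℂ) (x : ℝ) : ℂ :=
  ∫ s in Ioi (0 : ℝ), (1 - g (x * Real.exp (-s)))

lemma integral_exp_neg_two_mul_Ioi : ∫ s in Ioi (0 : ℝ), Real.exp (-s) ^ 2 = 1 / 2 := by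
  have h := integral_exp_mul_Ioi (a := -2) (by norm_num) 0
  rw [mul_zero, Real.exp_zero] at h
  rw [show (1 : ℝ) / 2 = -1 / -2 by norm_num, ← h]
  refine integral_congr_ae (Eventually.of_forall fun s => ?_)
  simp only [← Real.exp_nat_mul]
  congr 1
  push_cast
  ring

lemma integrableOn_exp_neg_sq_Ioi : IntegrableOn (fun s => Real.exp (-s) ^ 2) (Ioi (0 : ℝ)) := by
  refine (exp_neg_integrableOn_Ioi 0 (b := 2) two_pos).congr
    (Eventually.of_forall fun s => ?_)
  simp only [← Real.exp_nat_mul]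
  congr 1
  push_cast
  ring

namespace IsNearlyMultiplicative

variable {g : ℝ → ℂ}

lemma map_zero (hg : IsNearlyMultiplicative g) : g 0 = 1 := by
  have h := hg.norm_one_sub_le 0
  rw [abs_zero, norm_le_zero_iff, sub_eq_zero] at h
  exact h.symm

lemma continuous (hg : IsNearlyMultiplicative g) : Continuous g := by
  rw [continuous_iff_continuousAt]
  intro x
  rw [ContinuousAt, tendsto_iff_norm_sub_tendsto_zero]
  have hlim : Tendsto (fun y => (|x| + 1) * |y - x|) (𝓝 x) (𝓝 0) := by
    have : Continuous fun y : ℝ => (|x| + 1) * |y - x| := by fun_prop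
    simpa using this.tendsto x
  refine squeeze_zero (fun _ => norm_nonneg _) (fun y => ?_) hlim
  have h1 := hg.norm_sub_mul_le x (y - x)
  have h2 := hg.norm_one_sub_le (y - x)
  rw [add_sub_cancel] at h1
  calc ‖g y - g x‖ = ‖(g y - g x * g (y - x)) - g x * (1 - g (y - x))‖ := by congr 1; ring
    _ ≤ ‖g y - g x * g (y - x)‖ + ‖g x * (1 - g (y - x))‖ := norm_sub_le _ _
    _ ≤ |x| * |y - x| + 1 * |y - x| := by
        rw [norm_mul]
        gcongr
        exact hg.norm_le_one x
    _ = (|x| + 1) * |y - x| := by ring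

lemma integrableOn_one_sub (hg : IsNearlyMultiplicative g) (x : ℝ) :
    IntegrableOn (fun s => 1 - g (x * Real.exp (-s))) (Ioi 0) := by
  have hc := hg.continuous
  refine Integrable.mono' ((integrableOn_exp_neg_Ioi 0).const_mul |x|)
    (by fun_prop) (Eventually.of_forall fun s => ?_)
  refine (hg.norm_one_sub_le _).trans_eq ?_
  rw [abs_mul, abs_of_pos (Real.exp_pos _)]

lemma norm_poissonExponent_le (hg : IsNearlyMultiplicative g) (x : ℝ) :
    ‖poissonExponent g x‖ ≤ |x| := by
  calc ‖poissonExponent g x‖ ≤ ∫ s in Ioi (0 : ℝ), |x| * Real.exp (-s) := by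
        refine norm_integral_le_of_norm_le ((integrableOn_exp_neg_Ioi 0).const_mul |x|)
          (Eventually.of_forall fun s => ?_)
        refine (hg.norm_one_sub_le _).trans_eq ?_
        rw [abs_mul, abs_of_pos (Real.exp_pos _)]
    _ = |x| := by rw [integral_const_mul, integral_exp_neg_Ioi_zero, mul_one]

lemma re_poissonExponent_nonneg (hg : IsNearlyMultiplicative g) (x : ℝ) :
    0 ≤ (poissonExponent g x).re := by
  have h := Complex.reCLM.integral_comp_comm (hg.integrableOn_one_sub x)
  simp only [Complex.reCLM_apply] at h
  rw [poissonExponent, ← h]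
  refine integral_nonneg fun s => ?_
  have h1 := (Complex.re_le_norm _).trans (hg.norm_le_one (x * Real.exp (-s)))
  simpa using h1

/-- This is the contraction that drives the limit in `r`. A quadratic error at `x e^{-s}` carries
the factor `e^{-2s}`, whose integral is `1/2`, and the outer exponential is 1-Lipschitz on the
relevant half-plane. -/
lemma norm_exp_neg_poissonExponent_sub_le {f : ℝ → ℂ} (hg : IsNearlyMultiplicative g)
    (hf : IsNearlyMultiplicative f) {C : ℝ} (h : ∀ x, ‖f x - g x‖ ≤ C * x ^ 2) (x : ℝ) :
    ‖Complex.exp (-poissonExponent f x) - Complex.exp (-poissonExponent g x)‖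
      ≤ C / 2 * x ^ 2 := by
  refine (norm_exp_neg_sub_exp_neg_le (hf.re_poissonExponent_nonneg x)
    (hg.re_poissonExponent_nonneg x)).trans ?_
  rw [poissonExponent, poissonExponent,
    ← integral_sub (hf.integrableOn_one_sub x) (hg.integrableOn_one_sub x)]
  calc _ ≤ ∫ s in Ioi (0 : ℝ), C * x ^ 2 * Real.exp (-s) ^ 2 := by
        refine norm_integral_le_of_norm_le (integrableOn_exp_neg_sq_Ioi.const_mul _)
          (Eventually.of_forall fun s => ?_)
        rw [sub_sub_sub_cancel_left, norm_sub_rev]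
        refine (h _).trans_eq ?_
        ring
    _ = C / 2 * x ^ 2 := by rw [integral_const_mul, integral_exp_neg_two_mul_Ioi]; ring

/-- The recursion preserves the class with the same constants. For the last bound, `(1 - g(X+Y)) -
(1 - g X) - (1 - g Y)` is `-(g(X+Y) - g X g Y) - (1 - g X)(1 - g Y)`, at most `2|X||Y|`, and the `2`
is absorbed by `∫ e^{-2s} = 1/2`. -/
lemma exp_neg_poissonExponent (hg : IsNearlyMultiplicative g) :
    IsNearlyMultiplicative fun x => Complex.exp (-poissonExponent g x) where
  norm_le_one x := by
    rw [Complex.norm_exp]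
    simpa using hg.re_poissonExponent_nonneg x
  norm_one_sub_le x := by
    have h := norm_exp_neg_sub_exp_neg_le (a := 0) le_rfl (hg.re_poissonExponent_nonneg x)
    rw [neg_zero, Complex.exp_zero, zero_sub, norm_neg] at h
    exact h.trans (hg.norm_poissonExponent_le x)
  norm_sub_mul_le x y := by
    rw [← Complex.exp_add, ← neg_add]
    refine (norm_exp_neg_sub_exp_neg_le (hg.re_poissonExponent_nonneg _) (by
      simpa using add_nonneg (hg.re_poissonExponent_nonneg x)
        (hg.re_poissonExponent_nonneg y))).trans ?_
    rw [poissonExponent, poissonExponent, poissonExponent,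
      ← integral_add (hg.integrableOn_one_sub x) (hg.integrableOn_one_sub y),
      ← integral_sub (hg.integrableOn_one_sub _)
        (by exact (hg.integrableOn_one_sub x).add (hg.integrableOn_one_sub y))]
    calc _ ≤ ∫ s in Ioi (0 : ℝ), 2 * (|x| * |y|) * Real.exp (-s) ^ 2 := by
          refine norm_integral_le_of_norm_le (integrableOn_exp_neg_sq_Ioi.const_mul _)
            (Eventually.of_forall fun s => ?_)
          have he := Real.exp_pos (-s)
          set X := x * Real.exp (-s)
          set Y := y * Real.exp (-s)
          have h0 : (x + y) * Real.exp (-s) = X + Y := add_mul _ _ _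
          have hX : |X| = |x| * Real.exp (-s) := by rw [abs_mul, abs_of_pos he]
          have hY : |Y| = |y| * Real.exp (-s) := by rw [abs_mul, abs_of_pos he]
          calc ‖1 - g ((x + y) * Real.exp (-s)) - ((1 - g X) + (1 - g Y))‖
              = ‖-(g (X + Y) - g X * g Y) - (1 - g X) * (1 - g Y)‖ := by
                rw [h0]; congr 1; ring
            _ ≤ ‖g (X + Y) - g X * g Y‖ + ‖1 - g X‖ * ‖1 - g Y‖ := by
                refine (norm_sub_le _ _).trans_eq ?_
                rw [norm_neg, norm_mul]
            _ ≤ |X| * |Y| + |X| * |Y| := by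
                gcongr
                · exact hg.norm_sub_mul_le X Y
                · exact hg.norm_one_sub_le X
                · exact hg.norm_one_sub_le Y
            _ = 2 * (|x| * |y|) * Real.exp (-s) ^ 2 := by rw [hX, hY]; ring
      _ = |x| * |y| := by rw [integral_const_mul, integral_exp_neg_two_mul_Ioi]; ring

/-- Splitting off one summand at a time costs the product of that summand with the remaining sum.
The total is at most the sum over ordered pairs of different indices, which later measures how often
paths merge in a vertex. -/
lemma norm_sum_sub_prod_le (hg : IsNearlyMultiplicative g) {ι : Type*} (s : Finset ι)
    (x : ι → ℝ) (hx : ∀ i ∈ s, 0 ≤ x i) (t : ℝ) :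
    ‖g (t * ∑ i ∈ s, x i) - ∏ i ∈ s, g (t * x i)‖
      ≤ t ^ 2 * ((∑ i ∈ s, x i) ^ 2 - ∑ i ∈ s, x i ^ 2) := by
  classical
  induction s using Finset.induction_on with
  | empty => simp [hg.map_zero]
  | insert a s ha ih =>
    have ih := ih fun i hi => hx i (Finset.mem_insert_of_mem hi)
    have hs : 0 ≤ ∑ i ∈ s, x i :=
      Finset.sum_nonneg fun i hi => hx i (Finset.mem_insert_of_mem hi)
    have hxa := hx a (Finset.mem_insert_self a s)
    have hst := abs_nonneg t
    rw [Finset.sum_insert ha, Finset.prod_insert ha, Finset.sum_insert ha, mul_add]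
    set S := ∑ i ∈ s, x i
    set Q := ∏ i ∈ s, g (t * x i)
    calc ‖g (t * x a + t * S) - g (t * x a) * Q‖
        = ‖(g (t * x a + t * S) - g (t * x a) * g (t * S)) + g (t * x a) * (g (t * S) - Q)‖ := by
          congr 1; ring
      _ ≤ ‖g (t * x a + t * S) - g (t * x a) * g (t * S)‖ + ‖g (t * x a)‖ * ‖g (t * S) - Q‖ := by
          rw [← norm_mul]; exact norm_add_le _ _
      _ ≤ |t * x a| * |t * S| + 1 * (t ^ 2 * (S ^ 2 - ∑ i ∈ s, x i ^ 2)) := by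
          gcongr
          · exact hg.norm_sub_mul_le _ _
          · exact hg.norm_le_one _
      _ ≤ _ := by
          rw [abs_mul, abs_mul, abs_of_nonneg hxa, abs_of_nonneg hs, ← sq_abs t]
          have := mul_nonneg (sq_nonneg |t|) (mul_nonneg hxa hs)
          nlinarith

end IsNearlyMultiplicative

lemma isNearlyMultiplicative_exp : IsNearlyMultiplicative fun x : ℝ => Complex.exp (x * Complex.I) where
  norm_le_one x := (Complex.norm_exp_ofReal_mul_I x).le
  norm_one_sub_le x := by
    rw [norm_sub_rev, mul_comm]
    simpa using Real.norm_exp_I_mul_ofReal_sub_one_le (x := x)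
  norm_sub_mul_le x y := by
    rw [← Complex.exp_add, ← add_mul, ← Complex.ofReal_add, sub_self, norm_zero]
    positivity

/-- The characteristic function of the total mass of the `r`-th generation of the limiting
branching structure. -/
noncomputable def massCharFun : ℕ → ℝ → ℂ
  | 0 => fun x => Complex.exp (x * Complex.I)
  | r + 1 => fun x => Complex.exp (-poissonExponent (massCharFun r) x)

lemma isNearlyMultiplicative_massCharFun (r : ℕ) : IsNearlyMultiplicative (massCharFun r) := by
  induction r with
  | zero => exact isNearlyMultiplicative_exp
  | succ r ih => exact ih.exp_neg_poissonExponent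

/-- The characteristic function of the standard exponential law. -/
noncomputable def expCharFun (x : ℝ) : ℂ := (1 - x * Complex.I)⁻¹

lemma one_sub_mul_I_ne_zero (x : ℝ) : (1 - x * Complex.I : ℂ) ≠ 0 := fun h => by
  have := congrArg Complex.re h
  simp at this

lemma one_le_norm_one_sub_mul_I (x : ℝ) : 1 ≤ ‖(1 - x * Complex.I : ℂ)‖ := by
  refine le_trans ?_ (Complex.abs_re_le_norm _)
  simp

lemma one_sub_expCharFun (x : ℝ) :
    1 - expCharFun x = -(x * Complex.I) * expCharFun x := by
  have := one_sub_mul_I_ne_zero x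
  rw [expCharFun]
  field_simp
  ring

lemma norm_expCharFun_le (x : ℝ) : ‖expCharFun x‖ ≤ 1 := by
  rw [expCharFun, norm_inv]
  exact inv_le_one_of_one_le₀ (one_le_norm_one_sub_mul_I x)

/-- Everything follows from `1 - φ(x) = -ix φ(x)` and `(1 - ix)(1 - iy) = (1 - i(x+y)) - xy`,
together with `|φ| ≤ 1`. -/
lemma isNearlyMultiplicative_expCharFun : IsNearlyMultiplicative expCharFun where
  norm_le_one := norm_expCharFun_le
  norm_one_sub_le x := by
    rw [one_sub_expCharFun, norm_mul, norm_neg, norm_mul, Complex.norm_I, mul_one,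
      Complex.norm_real, Real.norm_eq_abs]
    exact mul_le_of_le_one_right (abs_nonneg _) (norm_expCharFun_le x)
  norm_sub_mul_le x y := by
    have h : expCharFun (x + y) - expCharFun x * expCharFun y
        = -(x * y) * (expCharFun (x + y) * (expCharFun x * expCharFun y)) := by
      have h1 := one_sub_mul_I_ne_zero x
      have h2 := one_sub_mul_I_ne_zero y
      have h3 := one_sub_mul_I_ne_zero (x + y)
      have h4 : (1 - x * Complex.I : ℂ) * (1 - y * Complex.I)
          = (1 - (x + y : ℝ) * Complex.I) - x * y := by
        push_cast
        linear_combination (x * y : ℂ) * Complex.I_sq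
      simp only [expCharFun]
      generalize (1 - (x + y : ℝ) * Complex.I : ℂ) = c at *
      generalize (1 - x * Complex.I : ℂ) = a at *
      generalize (1 - y * Complex.I : ℂ) = b at *
      field_simp
      linear_combination h4
    rw [h, norm_mul, norm_neg, norm_mul, Complex.norm_real, Complex.norm_real, Real.norm_eq_abs,
      Real.norm_eq_abs, norm_mul, norm_mul]
    refine mul_le_of_le_one_right (by positivity) ?_
    exact mul_le_one₀ (norm_expCharFun_le _) (by positivity)
      (mul_le_one₀ (norm_expCharFun_le _) (norm_nonneg _) (norm_expCharFun_le _))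

/-- The integrand `1 - φ(x e^{-s})` has the explicit primitive `-log(1 - i x e^{-s})`, which
vanishes at infinity. The real part of the argument is `1`, so the principal logarithm causes no
trouble. -/
lemma exp_neg_poissonExponent_expCharFun (x : ℝ) :
    Complex.exp (-poissonExponent expCharFun x) = expCharFun x := by
  have hd : ∀ s : ℝ, HasDerivAt
      (fun s : ℝ => -Complex.log (1 - (x * Real.exp (-s) : ℝ) * Complex.I))
      (1 - expCharFun (x * Real.exp (-s))) s := by
    intro s
    have h0 : HasDerivAt (fun s : ℝ => x * Real.exp (-s)) (-(x * Real.exp (-s))) s := by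
      have := ((hasDerivAt_neg s).exp).const_mul x
      simpa using this
    have h1 := ((h0.ofReal_comp.mul_const Complex.I).const_sub 1).clog_real
      (by
        rw [Complex.mem_slitPlane_iff]
        left
        simp only [Complex.sub_re, Complex.one_re, Complex.re_ofReal_mul, Complex.I_re]
        norm_num)
    convert! h1.neg using 1
    rw [one_sub_expCharFun, expCharFun]
    push_cast
    rw [div_eq_mul_inv]
    ring
  have hlim : Tendsto (fun s : ℝ => -Complex.log (1 - (x * Real.exp (-s) : ℝ) * Complex.I))
      atTop (𝓝 0) := by
    have h0 : Tendsto (fun s : ℝ => x * Real.exp (-s)) atTop (𝓝 0) := by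
      simpa using (Real.tendsto_exp_neg_atTop_nhds_zero).const_mul x
    have hc : ContinuousAt (fun y : ℝ => -Complex.log (1 - (y : ℝ) * Complex.I)) 0 := by
      refine (ContinuousAt.clog (by fun_prop) ?_).neg
      simp
    have := hc.tendsto.comp h0
    simp only [Complex.ofReal_zero, zero_mul, sub_zero, Complex.log_one, neg_zero] at this
    exact this
  have h := integral_Ioi_of_hasDerivAt_of_tendsto (a := 0) (hd 0).continuousAt.continuousWithinAt
    (fun s _ => hd s) (isNearlyMultiplicative_expCharFun.integrableOn_one_sub x) hlim
  rw [poissonExponent, h]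
  simp only [neg_zero, Real.exp_zero, mul_one, zero_sub, neg_neg]
  rw [Complex.exp_neg, Complex.exp_log (one_sub_mul_I_ne_zero x), expCharFun]

lemma norm_massCharFun_sub_expCharFun_le (r : ℕ) (x : ℝ) :
    ‖massCharFun r x - expCharFun x‖ ≤ 2 / 2 ^ r * x ^ 2 := by
  induction r generalizing x with
  | zero =>
    rw [pow_zero, div_one]
    change ‖Complex.exp (x * Complex.I) - expCharFun x‖ ≤ 2 * x ^ 2
    -- Near the origin both functions are `1 + ix` up to an error of size at most `x²`; away from
    -- it, both have modulus at most one and `2 ≤ 2x²`.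
    rcases le_total |x| 1 with hx | hx
    · have hn : ‖(x * Complex.I : ℂ)‖ = |x| := by simp
      have h1 := Complex.norm_exp_sub_one_sub_id_le (x := x * Complex.I) (hn.trans_le hx)
      have h2 : 1 + x * Complex.I - expCharFun x = (x : ℂ) ^ 2 * expCharFun x := by
        have := one_sub_mul_I_ne_zero x
        rw [expCharFun]
        field_simp
        linear_combination (-(x : ℂ) ^ 2) * Complex.I_sq
      calc ‖Complex.exp (x * Complex.I) - expCharFun x‖
          = ‖(Complex.exp (x * Complex.I) - 1 - x * Complex.I)
              + (1 + x * Complex.I - expCharFun x)‖ := by congr 1; ring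
        _ ≤ ‖(x * Complex.I : ℂ)‖ ^ 2 + ‖(x : ℂ) ^ 2 * expCharFun x‖ := by
            rw [← h2]
            exact (norm_add_le _ _).trans (by gcongr)
        _ ≤ |x| ^ 2 + |x| ^ 2 * 1 := by
            rw [hn, norm_mul, norm_pow, Complex.norm_real, Real.norm_eq_abs]
            gcongr
            exact norm_expCharFun_le x
        _ = 2 * x ^ 2 := by rw [sq_abs]; ring
    · refine (norm_sub_le _ _).trans ?_
      have h1 := isNearlyMultiplicative_exp.norm_le_one x
      have h2 := norm_expCharFun_le x
      have h3 : 1 ≤ x ^ 2 := by rw [← sq_abs]; exact one_le_pow₀ hx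
      linarith
  | succ r ih =>
    have h := isNearlyMultiplicative_expCharFun.norm_exp_neg_poissonExponent_sub_le
      (isNearlyMultiplicative_massCharFun r) ih x
    rw [exp_neg_poissonExponent_expCharFun] at h
    refine h.trans_eq ?_
    rw [pow_succ 2 r, div_div]

lemma tendsto_massCharFun (x : ℝ) :
    Tendsto (fun r => massCharFun r x) atTop (𝓝 (expCharFun x)) := by
  rw [tendsto_iff_norm_sub_tendsto_zero]
  refine squeeze_zero (fun _ => norm_nonneg _)
    (fun r => norm_massCharFun_sub_expCharFun_le r x) ?_
  have := ((tendsto_pow_atTop_nhds_zero_of_lt_one (r := (1 / 2 : ℝ)) (by norm_num)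
    (by norm_num)).const_mul 2).mul_const (x ^ 2)
  simpa [div_eq_mul_inv] using this

instance isProbabilityMeasure_expMeasure_one : IsProbabilityMeasure (expMeasure 1) :=
  isProbabilityMeasure_expMeasure one_pos

lemma integral_expMeasure_one {E : Type*} [NormedAddCommGroup E] [NormedSpace ℝ E] (f : ℝ → E) :
    ∫ x, f x ∂(expMeasure 1) = ∫ x in Ioi (0 : ℝ), Real.exp (-x) • f x := by
  rw [expMeasure, gammaMeasure, integral_withDensity_eq_integral_toReal_smul
    (by unfold gammaPDF; fun_prop) (Eventually.of_forall fun x => by simp [gammaPDF]),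
    ← integral_indicator measurableSet_Ioi]
  refine integral_congr_ae ?_
  filter_upwards [compl_mem_ae_iff.2 (measure_singleton (0 : ℝ))] with x hx
  have hx : x ≠ 0 := hx
  rcases lt_or_gt_of_ne hx with h | h
  · rw [gammaPDF_of_neg h, indicator_of_notMem (by simpa using h.le)]
    simp
  · rw [gammaPDF_of_nonneg h.le, indicator_of_mem (by simpa using h)]
    simp [Real.exp_nonneg]

lemma charFun_expMeasure_one (t : ℝ) : charFun (expMeasure 1) t = expCharFun t := by
  rw [charFun_apply_real, integral_expMeasure_one]
  have h := integral_exp_mul_complex_Ioi (a := t * Complex.I - 1) (by simp) 0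
  have hne : (t * Complex.I - 1 : ℂ) ≠ 0 := fun h0 => by
    have := congrArg Complex.re h0
    simp at this
  rw [Complex.ofReal_zero, mul_zero, Complex.exp_zero] at h
  have h1 : expCharFun t = -1 / (t * Complex.I - 1) := by
    rw [expCharFun, ← neg_sub, inv_neg, neg_div, one_div]
  rw [h1, ← h]
  refine integral_congr_ae (Eventually.of_forall fun x => ?_)
  simp only [Complex.real_smul, Complex.ofReal_exp, ← Complex.exp_add]
  congr 1
  push_cast
  ring
end CharacteristicFunctions

/-! ### Resampling of coordinates, conditional expectations, and sums of exponentials. -/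

section ProductMeasures

open Set Topology

variable {ι : Type*} {α : Type*} [MeasurableSpace α]

lemma measurable_piecewise_prod (s : Set ι) [DecidablePred (· ∈ s)] :
    Measurable fun p : (ι → α) × (ι → α) => s.piecewise p.1 p.2 := by
  refine measurable_pi_lambda _ fun i => ?_
  by_cases hi : i ∈ s
  · simp only [hi, piecewise_eq_of_mem]
    fun_prop
  · simp only [hi, not_false_eq_true, piecewise_eq_of_notMem]
    fun_prop

variable [Fintype ι]

/-- Resampling some of the coordinates independently does not change a product law. -/
lemma measurePreserving_piecewise (μ : Measure α) [IsProbabilityMeasure μ] (s : Set ι)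
    [DecidablePred (· ∈ s)] :
    MeasurePreserving (fun p : (ι → α) × (ι → α) => s.piecewise p.1 p.2)
      ((Measure.pi fun _ => μ).prod (Measure.pi fun _ => μ)) (Measure.pi fun _ => μ) where
  measurable := measurable_piecewise_prod s
  map_eq := by
    refine (Measure.pi_eq fun t ht => ?_).symm
    rw [Measure.map_apply (measurable_piecewise_prod s) (.univ_pi ht)]
    have h : (fun p : (ι → α) × (ι → α) => s.piecewise p.1 p.2) ⁻¹' univ.pi t
        = univ.pi (fun i => if i ∈ s then t i else univ)
          ×ˢ univ.pi (fun i => if i ∈ s then univ else t i) := by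
      ext p
      simp only [mem_preimage, mem_univ_pi, mem_prod, ← forall_and]
      refine forall_congr' fun i => ?_
      by_cases hi : i ∈ s <;> simp [hi]
    rw [h, Measure.prod_prod, Measure.pi_pi, Measure.pi_pi, ← Finset.prod_mul_distrib]
    refine Finset.prod_congr rfl fun i _ => ?_
    by_cases hi : i ∈ s <;> simp [hi]

lemma integral_pi_eq_integral_piecewise {E : Type*} [NormedAddCommGroup E] [NormedSpace ℝ E]
    (μ : Measure α) [IsProbabilityMeasure μ] (s : Set ι) [DecidablePred (· ∈ s)]
    {f : (ι → α) → E} (hf : Integrable f (Measure.pi fun _ => μ)) :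
    ∫ z, f z ∂(Measure.pi fun _ => μ)
      = ∫ x, ∫ y, f (s.piecewise x y) ∂(Measure.pi fun _ => μ) ∂(Measure.pi fun _ => μ) := by
  have h := measurePreserving_piecewise μ s
  have hf' := h.integrable_comp_of_integrable hf
  rw [← h.map_eq, integral_map h.measurable.aemeasurable
    (by rw [h.map_eq]; exact hf.aestronglyMeasurable), h.map_eq]
  exact integral_prod _ hf'

/-- Averaging over an independent copy of the coordinates outside `s` leaves a function of the
coordinates in `s`. Since resampling preserves the product law, it has the right integral over each
event determined by those coordinates. -/
lemma condExp_comap_restrict_ae_eq {Ω : Type*} {mΩ : MeasurableSpace Ω} (P : Measure Ω)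
    [IsProbabilityMeasure P] (μ : Measure α) [IsProbabilityMeasure μ] {X : Ω → ι → α}
    (hX : Measurable X) (hlaw : P.map X = Measure.pi fun _ => μ) (s : Set ι)
    [DecidablePred (· ∈ s)] {f : (ι → α) → ℝ} (hf : Measurable f) {C : ℝ}
    (hC : ∀ x, ‖f x‖ ≤ C) :
    P[fun ω => f (X ω) | MeasurableSpace.comap (fun ω (i : s) => X ω i) inferInstance]
      =ᵐ[P] fun ω => ∫ y, f (s.piecewise (X ω) y) ∂(Measure.pi fun _ => μ) := by
  have hR : Measurable fun (x : ι → α) (i : s) => x i := by fun_prop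
  have hm : MeasurableSpace.comap (fun ω (i : s) => X ω i) inferInstance ≤ mΩ :=
    (hR.comp hX).comap_le
  have hfX : Integrable (fun ω => f (X ω)) P :=
    .of_bound (hf.comp hX).aestronglyMeasurable C (Eventually.of_forall fun ω => hC _)
  have hpw : ∀ x y : ι → α, s.piecewise x y = fun i => if h : i ∈ s then x i else y i := by
    intro x y; ext i; by_cases hi : i ∈ s <;> simp [hi]
  -- Writing the average as a function on `s → α` makes its measurability for the generated
  -- sigma-algebra immediate.
  let G : (s → α) → ℝ := fun u =>
    ∫ y, f (fun i => if h : i ∈ s then u ⟨i, h⟩ else y i) ∂(Measure.pi fun _ => μ)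
  have hG : StronglyMeasurable G := by
    refine StronglyMeasurable.integral_prod_right' (f := fun (p : (s → α) × (ι → α)) =>
      f (fun i => if h : i ∈ s then p.1 ⟨i, h⟩ else p.2 i)) ?_
    refine (hf.comp (measurable_pi_lambda _ fun i => ?_)).stronglyMeasurable
    by_cases hi : i ∈ s
    · simp only [hi, dite_true]
      fun_prop
    · simp only [hi, dite_false]
      fun_prop
  have hGx : ∀ x : ι → α, ∫ y, f (s.piecewise x y) ∂(Measure.pi fun _ => μ)
      = G fun i => x i := by
    intro x
    simp only [G, hpw]
  have hGC : ∀ u, ‖G u‖ ≤ C := fun u => by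
    refine (norm_integral_le_of_norm_le_const (Eventually.of_forall fun y => hC _)).trans_eq ?_
    simp
  have hGi : Integrable (fun ω => G fun i => X ω i) P :=
    .of_bound (hG.measurable.comp (hR.comp hX)).aestronglyMeasurable C
      (Eventually.of_forall fun ω => hGC fun i => X ω i)
  simp only [hGx]
  refine (ae_eq_condExp_of_forall_setIntegral_eq hm hfX (fun _ _ _ => hGi.integrableOn) ?_ ?_).symm
  · rintro _ ⟨T, hT, rfl⟩ -
    have hS : MeasurableSet ((fun ω (i : s) => X ω i) ⁻¹' T) := (hR.comp hX) hT
    rw [← integral_indicator hS, ← integral_indicator hS]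
    let F : (ι → α) → ℝ := ((fun (x : ι → α) (i : s) => x i) ⁻¹' T).indicator f
    have hF : Measurable F := hf.indicator (hR hT)
    have hFC : ∀ x, ‖F x‖ ≤ C := fun x =>
      (norm_indicator_le_norm_self _ _).trans (hC x)
    have hFi : Integrable F (Measure.pi fun _ => μ) :=
      .of_bound hF.aestronglyMeasurable C (Eventually.of_forall hFC)
    have e1 : ∫ ω, ((fun ω (i : s) => X ω i) ⁻¹' T).indicator (fun ω => f (X ω)) ω ∂P
        = ∫ z, F z ∂(Measure.pi fun _ => μ) := by
      rw [← hlaw, integral_map hX.aemeasurable hF.aestronglyMeasurable]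
      rfl
    rw [e1, integral_pi_eq_integral_piecewise μ s hFi]
    have e2 : ∀ x : ι → α, ∫ y, F (s.piecewise x y) ∂(Measure.pi fun _ => μ)
        = T.indicator G fun i => x i := by
      intro x
      have hr : ∀ y : ι → α, (fun i : s => s.piecewise x y i) = fun i : s => x i :=
        fun y => funext fun i => by simp
      by_cases hx : (fun i : s => x i) ∈ T
      · rw [indicator_of_mem hx, ← hGx]
        refine integral_congr_ae (Eventually.of_forall fun y => ?_)
        refine indicator_of_mem ?_ _
        rwa [mem_preimage, hr]
      · rw [indicator_of_notMem hx]
        refine integral_eq_zero_of_ae (Eventually.of_forall fun y => ?_)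
        refine indicator_of_notMem ?_ _
        rwa [mem_preimage, hr]
    simp only [e2]
    have hm2 : Measurable fun x : ι → α => T.indicator G fun i => x i :=
      (hG.measurable.indicator hT).comp hR
    rw [← hlaw, integral_map hX.aemeasurable hm2.aestronglyMeasurable]
    rfl
  · exact (hG.comp_measurable (comap_measurable _)).aestronglyMeasurable

lemma integral_exp_neg_mul_abs_expMeasure {θ : ℝ} (hθ : 0 ≤ θ) :
    ∫ x, Real.exp (-(θ * |x|)) ∂(expMeasure 1) = 1 / (1 + θ) := by
  rw [integral_expMeasure_one]
  have h := integral_exp_mul_Ioi (a := -(1 + θ)) (by linarith) 0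
  rw [mul_zero, Real.exp_zero, neg_div_neg_eq] at h
  rw [← h]
  refine setIntegral_congr_fun measurableSet_Ioi fun x hx => ?_
  have hx : 0 < x := hx
  simp only [smul_eq_mul, ← Real.exp_add, abs_of_pos hx]
  congr 1
  ring

lemma ae_nonneg_expMeasure : ∀ᵐ x ∂(expMeasure 1), 0 ≤ x := by
  rw [ae_iff, expMeasure, gammaMeasure, withDensity_apply _ (by measurability)]
  simp only [not_le]
  exact lintegral_gammaPDF_of_nonpos le_rfl

/-- On `[0, x]` the two exponentials merge into `e^{-x}`, so only the integral of `y^{m-1}` is left,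
and `m Γ(m) = Γ(m+1)`. -/
lemma gammaPDF_lconvolution_exponentialPDF {m : ℕ} (hm : 0 < m) (x : ℝ) :
    lconvolution (gammaPDF m 1) (gammaPDF 1 1) volume x = gammaPDF (m + 1) 1 x := by
  rw [lconvolution_def]
  have hm' : (0 : ℝ) < m := by exact_mod_cast hm
  rcases lt_or_ge x 0 with hx | hx
  · rw [gammaPDF_of_neg hx]
    refine lintegral_eq_zero_of_ae_eq_zero (Eventually.of_forall fun y => ?_)
    rcases lt_or_ge y 0 with hy | hy
    · simp [gammaPDF_of_neg hy]
    · simp [gammaPDF_of_neg (show -y + x < 0 by linarith)]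
  · have h1 : ∀ y, gammaPDF m 1 y * gammaPDF 1 1 (-y + x)
        = (Icc 0 x).indicator (fun y => ENNReal.ofReal
          (Real.exp (-x) / Real.Gamma m * y ^ ((m : ℝ) - 1))) y := by
      intro y
      by_cases hy : y ∈ Icc 0 x
      · rw [indicator_of_mem hy, gammaPDF_of_nonneg hy.1,
          gammaPDF_of_nonneg (by linarith [hy.2]), ← ENNReal.ofReal_mul
          (by have := Real.Gamma_pos_of_pos hm'; have := hy.1; positivity)]
        congr 1
        simp only [Real.one_rpow, Real.Gamma_one, sub_self, Real.rpow_zero, one_mul, mul_one,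
          div_one]
        rw [show Real.exp (-x) = Real.exp (-y) * Real.exp (-(-y + x)) by
          rw [← Real.exp_add]; congr 1; ring]
        ring
      · rw [indicator_of_notMem hy]
        rcases lt_or_ge y 0 with hy0 | hy0
        · simp [gammaPDF_of_neg hy0]
        · have : -y + x < 0 := by
            by_contra! hc
            exact hy ⟨hy0, by linarith⟩
          simp [gammaPDF_of_neg this]
    simp only [h1]
    rw [lintegral_indicator measurableSet_Icc, ← ofReal_integral_eq_lintegral_ofReal,
      gammaPDF_of_nonneg hx, integral_const_mul, integral_Icc_eq_integral_Ioc,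
      ← intervalIntegral.integral_of_le hx, integral_rpow (Or.inl (by linarith)),
      Real.Gamma_add_one hm'.ne']
    · have := (Real.Gamma_pos_of_pos hm').ne'
      congr 1
      rw [sub_add_cancel, Real.zero_rpow hm'.ne', add_sub_cancel_right, Real.one_rpow, sub_zero,
        one_mul]
      field_simp
    · refine Integrable.const_mul ?_ _
      have := (intervalIntegral.intervalIntegrable_rpow' (a := 0) (b := x)
        (show (-1 : ℝ) < (m : ℝ) - 1 by linarith))
      rwa [intervalIntegrable_iff_integrableOn_Icc_of_le hx] at this
    · refine (ae_restrict_iff' measurableSet_Icc).2 (Eventually.of_forall fun y hy => ?_)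
      have := Real.Gamma_pos_of_pos hm'
      have := hy.1
      simp only [Pi.zero_apply]
      positivity

/-- A sum of independent standard exponentials has a Gamma law. -/
lemma map_sum_pi_expMeasure {T : Finset ι} (hT : T.Nonempty) :
    (Measure.pi fun _ : ι => expMeasure 1).map (fun y => ∑ i ∈ T, y i)
      = gammaMeasure T.card 1 := by
  classical
  induction hT using Finset.Nonempty.cons_induction with
  | singleton a =>
    have := (measurePreserving_eval (fun _ : ι => expMeasure 1) a).map_eq
    simpa [expMeasure] using this
  | cons a T ha hT ih =>
    have hind : iIndepFun (fun (i : ι) (y : ι → ℝ) => y i)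
        (Measure.pi fun _ : ι => expMeasure 1) :=
      iIndepFun_pi (X := fun _ x => x) fun _ => aemeasurable_id
    have h2 := hind.indepFun_finsetSum_of_notMem (fun i => measurable_pi_apply i) ha
    have hfun : (fun y : ι → ℝ => ∑ i ∈ T.cons a ha, y i)
        = (∑ i ∈ T, fun y : ι → ℝ => y i) + fun y => y a := by
      ext y
      simp [Finset.sum_insert ha, add_comm]
    have hsum : (∑ i ∈ T, fun y : ι → ℝ => y i) = fun y => ∑ i ∈ T, y i := by
      ext y; simp
    have h3 := (measurePreserving_eval (fun _ : ι => expMeasure 1) a).map_eq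
    rw [hfun, h2.map_add_eq_map_conv_map (by rw [hsum]; fun_prop) (by fun_prop), hsum, ih]
    rw [show (Measure.pi fun _ : ι => expMeasure 1).map (fun y => y a) = expMeasure 1 from h3,
      expMeasure, gammaMeasure, gammaMeasure, conv_withDensity_eq_lconvolution
        (by unfold gammaPDF; fun_prop) (by unfold gammaPDF; fun_prop), gammaMeasure]
    congr 1
    ext x
    rw [gammaPDF_lconvolution_exponentialPDF hT.card_pos, Finset.card_cons]
    push_cast
    rfl

end ProductMeasures

/-! ### Combinatorics of oriented paths: heights, path counts, and transfer matrices. -/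

section Paths

variable {n : ℕ}

/-- The number of coordinates of a vertex that are equal to one. -/
abbrev height (u : Vertex n) : ℕ := hammingDist u (origin n)

lemma height_eq_card (u : Vertex n) : height u = (Finset.univ.filter fun i => u i = true).card := by
  simp [height, hammingDist, origin]

lemma height_origin : height (origin n) = 0 := hammingDist_self _

lemma height_target : height (target n) = n := by
  simp [height_eq_card, target]

lemma height_update {u : Vertex n} {j : Fin n} (hj : u j = false) :
    height (Function.update u j true) = height u + 1 := by
  rw [height_eq_card, height_eq_card, ← Finset.card_insert_of_notMem (a := j) (by simp [hj])]
  congr 1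
  ext i
  by_cases h : i = j
  · subst h; simp
  · simp [h]

lemma IsEdge.height_eq {u v : Vertex n} (h : IsEdge u v) : height v = height u + 1 := by
  obtain ⟨j, hj, rfl⟩ := h
  exact height_update hj

lemma Edge.level_eq_height (e : Edge n) : e.level = height e.1.1 := by
  have := e.2.height_eq
  rw [Edge.level]
  simp only [height] at this
  rw [this, min_eq_left (Nat.le_succ _)]

lemma card_zero_coordinates (u : Vertex n) :
    (Finset.univ.filter fun j => u j = false).card = n - height u := by
  have h := Finset.card_filter_add_card_filter_not (s := (Finset.univ : Finset (Fin n)))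
    (fun j => u j = true)
  simp only [Bool.not_eq_true, Finset.card_univ, Fintype.card_fin] at h
  rw [height_eq_card]
  omega

lemma sum_isEdge_right {M : Type*} [AddCommMonoid M] (u : Vertex n) (F : Vertex n → M) :
    ∑ v, (if IsEdge u v then F v else 0)
      = ∑ j with u j = false, F (Function.update u j true) := by
  rw [← Finset.sum_filter]
  symm
  refine Finset.sum_bij (fun j _ => Function.update u j true) ?_ ?_ ?_ ?_
  · intro j hj
    simp only [Finset.mem_filter, Finset.mem_univ, true_and] at hj ⊢
    exact ⟨j, hj, rfl⟩
  · intro i hi j hj h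
    simp only [Finset.mem_filter, Finset.mem_univ, true_and] at hi hj
    by_contra hij
    have := congrFun h i
    simp [hij, hi] at this
  · intro v hv
    simp only [Finset.mem_filter, Finset.mem_univ, true_and] at hv
    obtain ⟨j, hj, rfl⟩ := hv
    exact ⟨j, by simpa using hj, rfl⟩
  · intros; rfl

lemma sum_isEdge_left {M : Type*} [AddCommMonoid M] (v : Vertex n) (F : Vertex n → M) :
    ∑ u, (if IsEdge u v then F u else 0)
      = ∑ j with v j = true, F (Function.update v j false) := by
  rw [← Finset.sum_filter]
  symm
  refine Finset.sum_bij (fun j _ => Function.update v j false) ?_ ?_ ?_ ?_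
  · intro j hj
    simp only [Finset.mem_filter, Finset.mem_univ, true_and] at hj ⊢
    exact ⟨j, by simp, by simp [← hj]⟩
  · intro i hi j hj h
    simp only [Finset.mem_filter, Finset.mem_univ, true_and] at hi hj
    by_contra hij
    have := congrFun h i
    simp [hij, hi] at this
  · intro u hu
    simp only [Finset.mem_filter, Finset.mem_univ, true_and] at hu
    obtain ⟨j, hj, rfl⟩ := hu
    exact ⟨j, by simp, by simp [← hj]⟩
  · intros; rfl

lemma card_isEdge_right (u : Vertex n) :
    ∑ v : Vertex n, (if IsEdge u v then (1 : ℝ) else 0) = (n - height u : ℕ) := by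
  rw [sum_isEdge_right u fun _ => (1 : ℝ), Finset.sum_const, card_zero_coordinates, nsmul_one]

/-- The adjacency matrix of the oriented hypercube. -/
noncomputable def adjMatrix (n : ℕ) : Matrix (Vertex n) (Vertex n) ℝ :=
  fun u v => if IsEdge u v then 1 else 0

/-- A path from `u` to `v` switches on the `k` coordinates in which they differ, in any of the `k!`
orders. The induction removes the coordinate that is switched on last. -/
lemma adjMatrix_pow_apply (k : ℕ) (u v : Vertex n) :
    (adjMatrix n ^ k) u v
      = if (∀ i, u i = true → v i = true) ∧ height v = height u + k then (k.factorial : ℝ)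
        else 0 := by
  induction k generalizing v with
  | zero =>
    rw [pow_zero, Matrix.one_apply]
    refine if_congr ⟨?_, ?_⟩ (by simp) rfl
    · rintro rfl; simp
    · rintro ⟨h, hc⟩
      rw [height_eq_card, height_eq_card, add_zero] at hc
      have hsub : (Finset.univ.filter fun i => u i = true)
          ⊆ Finset.univ.filter fun i => v i = true := by
        intro i hi
        simp only [Finset.mem_filter, Finset.mem_univ, true_and] at hi ⊢
        exact h i hi
      have := Finset.eq_of_subset_of_card_le hsub hc.le
      ext i
      have hi := congrArg (fun s => i ∈ s) this
      simp only [Finset.mem_filter, Finset.mem_univ, true_and, eq_iff_iff] at hi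
      exact Bool.eq_iff_iff.2 hi
  | succ k ih =>
    rw [pow_succ, Matrix.mul_apply]
    have h1 : ∀ w, (adjMatrix n ^ k) u w * adjMatrix n w v
        = if IsEdge w v then (adjMatrix n ^ k) u w else 0 := by
      intro w
      rw [adjMatrix]
      split_ifs <;> simp
    simp only [h1]
    rw [sum_isEdge_left v fun w => (adjMatrix n ^ k) u w]
    have hh : ∀ j, v j = true → height v = height (Function.update v j false) + 1 := by
      intro j hj
      have := height_update (u := Function.update v j false) (j := j) (by simp)
      rw [← this]
      simp [← hj]
    by_cases huv : (∀ i, u i = true → v i = true) ∧ height v = height u + (k + 1)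
    · rw [if_pos huv]
      have hsub : (Finset.univ.filter fun i => u i = true)
          ⊆ Finset.univ.filter fun i => v i = true := by
        intro i hi
        simp only [Finset.mem_filter, Finset.mem_univ, true_and] at hi ⊢
        exact huv.1 i hi
      have h2 : ∀ j ∈ Finset.univ.filter fun i => v i = true,
          (adjMatrix n ^ k) u (Function.update v j false)
            = if u j = true then 0 else (k.factorial : ℝ) := by
        intro j hj
        simp only [Finset.mem_filter, Finset.mem_univ, true_and] at hj
        have := hh j hj
        rw [ih]
        by_cases huj : u j = true
        · rw [if_pos huj, if_neg]
          rintro ⟨h, -⟩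
          simpa using h j huj
        · rw [if_neg huj, if_pos]
          refine ⟨fun i hi => ?_, by omega⟩
          have hij : i ≠ j := by rintro rfl; exact huj hi
          simpa [hij] using huv.1 i hi
      rw [Finset.sum_congr rfl h2, Finset.sum_ite, Finset.sum_const_zero, zero_add,
        Finset.sum_const, nsmul_eq_mul, Nat.factorial_succ, Nat.cast_mul]
      congr 2
      have h3 := Finset.card_sdiff_add_card_eq_card hsub
      have h4 : ((Finset.univ.filter fun i => v i = true).filter fun i => ¬ u i = true)
          = (Finset.univ.filter fun i => v i = true) \ Finset.univ.filter fun i => u i = true := by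
        ext i; simp
      rw [← height_eq_card, ← height_eq_card] at h3
      rw [h4]
      omega
    · rw [if_neg huv]
      refine Finset.sum_eq_zero fun j hj => ?_
      simp only [Finset.mem_filter, Finset.mem_univ, true_and] at hj
      have := hh j hj
      rw [ih, if_neg]
      rintro ⟨h, hc⟩
      refine huv ⟨fun i hi => ?_, by omega⟩
      by_cases hij : i = j
      · rw [hij, hj]
      · simpa [hij] using h i hi

/-- The matrices may depend on the step. This is what permits Boltzmann weights on the outer steps
and plain counting on the inner ones. -/
lemma sum_prod_eq_prod_matrix {V : Type*} [Fintype V] [DecidableEq V] (f : ℕ → Matrix V V ℝ)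
    (a : V) (N : ℕ) (b : V) :
    ∑ p : Fin (N + 1) → V, (if p 0 = a ∧ p (Fin.last N) = b then
      ∏ i : Fin N, f i (p i.castSucc) (p i.succ) else 0) = ((List.range N).map f).prod a b := by
  induction N generalizing b with
  | zero =>
    rw [← (Equiv.funUnique (Fin 1) V).symm.sum_comp]
    simp only [Equiv.funUnique_symm_apply, Finset.univ_eq_empty, Finset.prod_empty,
      List.range_zero, List.map_nil, List.prod_nil, Matrix.one_apply]
    by_cases h : a = b
    · subst h; simp [uniqueElim]
    · rw [if_neg h]
      refine Finset.sum_eq_zero fun x _ => if_neg ?_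
      rintro ⟨h1, h2⟩
      exact h (h1.symm.trans h2)
  | succ N ih =>
    rw [List.range_succ, List.map_append, List.prod_append, Matrix.mul_apply,
      ← (Fin.snocEquiv fun _ => V).sum_comp, Fintype.sum_prod_type_right]
    simp only [← ih, Finset.sum_mul]
    conv_rhs => rw [Finset.sum_comm]
    refine Finset.sum_congr rfl fun p _ => ?_
    simp only [Fin.snocEquiv_apply, List.map_cons, List.map_nil, List.prod_cons, List.prod_nil,
      mul_one, Fin.snoc_last]
    have h0 : ∀ x : V, (Fin.snoc (α := fun _ => V) p x) 0 = p 0 := fun x => by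
      rw [← Fin.castSucc_zero, Fin.snoc_castSucc]
    have hp : ∀ x : V, ∏ i : Fin (N + 1), f i ((Fin.snoc (α := fun _ => V) p x) i.castSucc)
        ((Fin.snoc (α := fun _ => V) p x) i.succ)
        = (∏ i : Fin N, f i (p i.castSucc) (p i.succ)) * f N (p (Fin.last N)) x := by
      intro x
      rw [Fin.prod_univ_castSucc]
      congr 1
      · refine Finset.prod_congr rfl fun i _ => ?_
        rw [Fin.snoc_castSucc, ← Fin.castSucc_succ, Fin.snoc_castSucc]
        rfl
      · rw [Fin.snoc_castSucc, Fin.succ_last, Fin.snoc_last]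
        rfl
    simp only [h0, hp]
    rw [Finset.sum_eq_single b, Finset.sum_eq_single (p (Fin.last N))]
    · simp only [and_true]
      split_ifs <;> simp
    · intro x _ hx
      rw [if_neg (by tauto), zero_mul]
    · simp
    · intro x _ hx
      rw [if_neg (by tauto)]
    · simp

lemma sum_orientedPath_eq (f : ℕ → Matrix (Vertex n) (Vertex n) ℝ)
    (hf : ∀ i u v, ¬ IsEdge u v → f i u v = 0) :
    ∑ p : OrientedPath n, ∏ i : Fin n, f i (p.1 i.castSucc) (p.1 i.succ)
      = ((List.range n).map f).prod (origin n) (target n) := by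
  rw [← sum_prod_eq_prod_matrix, ← Finset.sum_filter]
  have h := Finset.sum_subtype (F := inferInstance) (p := fun p : Fin (n + 1) → Vertex n =>
    p 0 = origin n ∧ p (Fin.last n) = target n ∧ ∀ i : Fin n, IsEdge (p i.castSucc) (p i.succ))
    (Finset.univ.filter fun p : Fin (n + 1) → Vertex n =>
      p 0 = origin n ∧ p (Fin.last n) = target n ∧ ∀ i : Fin n, IsEdge (p i.castSucc) (p i.succ))
    (by simp) fun p => ∏ i : Fin n, f i (p i.castSucc) (p i.succ)
  rw [← h]
  refine Finset.sum_subset (fun p hp => ?_) fun p hp hp' => ?_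
  · simp only [Finset.mem_filter, Finset.mem_univ, true_and] at hp ⊢
    exact ⟨hp.1, hp.2.1⟩
  · simp only [Finset.mem_filter, Finset.mem_univ, true_and] at hp hp'
    have : ∃ i : Fin n, ¬ IsEdge (p i.castSucc) (p i.succ) := by
      by_contra! hc
      exact hp' ⟨hp.1, hp.2, hc⟩
    obtain ⟨i, hi⟩ := this
    exact Finset.prod_eq_zero (Finset.mem_univ i) (hf i _ _ hi)

lemma card_orientedPath : (Fintype.card (OrientedPath n) : ℝ) = n.factorial := by
  have h := sum_orientedPath_eq (n := n) (fun _ => adjMatrix n) fun i u v huv => if_neg huv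
  have h1 : ∀ p : OrientedPath n,
      ∏ i : Fin n, adjMatrix n (p.1 i.castSucc) (p.1 i.succ) = 1 := fun p =>
    Finset.prod_eq_one fun i _ => if_pos (p.2.2.2 i)
  simp only [h1, Finset.sum_const, Finset.card_univ, nsmul_eq_mul, mul_one] at h
  rw [h, List.map_const', List.prod_replicate, List.length_range, adjMatrix_pow_apply, if_pos]
  exact ⟨fun i _ => rfl, by rw [height_target, height_origin, zero_add]⟩

lemma height_orientedPath (p : OrientedPath n) (i : Fin (n + 1)) : height (p.1 i) = i := by
  induction i using Fin.induction with
  | zero => rw [p.2.1, height_origin]; rfl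
  | succ i ih => rw [(p.2.2.2 i).height_eq, ih]; simp

lemma level_orientedPath_edge (p : OrientedPath n) (i : Fin n) :
    (OrientedPath.edge p i).level = i := by
  rw [Edge.level_eq_height, OrientedPath.edge, height_orientedPath]
  simp

lemma orientedPath_edge_injective (p : OrientedPath n) :
    Function.Injective (OrientedPath.edge p) := fun i j h => by
  have := congrArg Edge.level h
  rw [level_orientedPath_edge, level_orientedPath_edge] at this
  exact Fin.ext this

/-- Step `i` starts at height `i`, so whether it is outer does not depend on the path. The
subtraction on the right is truncated, unlike the integer one in `Edge.IsOuter`; both conditions are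
vacuous when `n ≤ r`. -/
lemma isOuter_orientedPath_edge {r : ℕ} (p : OrientedPath n) (i : Fin n) :
    (OrientedPath.edge p i).IsOuter r ↔ (i : ℕ) < r ∨ n - r ≤ (i : ℕ) := by
  rw [Edge.IsOuter, level_orientedPath_edge]
  have := i.2
  omega

/-- The steps of an oriented path that use outer edges. -/
abbrev outerSteps (n r : ℕ) : Finset (Fin n) :=
  Finset.univ.filter fun i : Fin n => (i : ℕ) < r ∨ n - r ≤ (i : ℕ)

lemma card_outerSteps {r : ℕ} (h : 2 * r ≤ n) : (outerSteps n r).card = 2 * r := by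
  have h1 : (outerSteps n r).map Fin.valEmbedding = Finset.range r ∪ Finset.Ico (n - r) n := by
    ext i
    simp only [Finset.mem_map, Finset.mem_filter, Finset.mem_univ, true_and,
      Fin.valEmbedding_apply, Finset.mem_union, Finset.mem_range, Finset.mem_Ico]
    constructor
    · rintro ⟨j, hj, rfl⟩
      have := j.2
      omega
    · intro hi
      exact ⟨⟨i, by omega⟩, by simp; omega, rfl⟩
  rw [← Finset.card_map Fin.valEmbedding, h1, Finset.card_union_of_disjoint, Finset.card_range,
    Nat.card_Ico]
  · omega
  · rw [Finset.disjoint_left]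
    intro i hi hi'
    simp only [Finset.mem_range, Finset.mem_Ico] at hi hi'
    omega

lemma card_compl_outerSteps {r : ℕ} (h : 2 * r ≤ n) : ((outerSteps n r)ᶜ).card = n - 2 * r := by
  rw [Finset.card_compl, card_outerSteps h, Fintype.card_fin]

end Paths

/-! ### Weighted path sums out of the origin and into the target, and their reversal symmetry. -/

section WeightMatrices

variable {n : ℕ}

/-- The matrix of the values of a function on the edges. -/
noncomputable def edgeMatrix (w : Edge n → ℝ) : Matrix (Vertex n) (Vertex n) ℝ :=
  fun u v => if h : IsEdge u v then w ⟨(u, v), h⟩ else 0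

lemma edgeMatrix_eq_zero (w : Edge n → ℝ) {u v : Vertex n} (h : ¬ IsEdge u v) :
    edgeMatrix w u v = 0 := dif_neg h

lemma edgeMatrix_nonneg {w : Edge n → ℝ} (hw : ∀ e, 0 ≤ w e) (u v : Vertex n) :
    0 ≤ edgeMatrix w u v := by
  rw [edgeMatrix]
  split_ifs
  exacts [hw _, le_rfl]

lemma edgeMatrix_pow_nonneg {w : Edge n → ℝ} (hw : ∀ e, 0 ≤ w e) (k : ℕ) (u v : Vertex n) :
    0 ≤ (edgeMatrix w ^ k) u v := by
  induction k generalizing v with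
  | zero => rw [pow_zero, Matrix.one_apply]; split_ifs <;> norm_num
  | succ k ih =>
    rw [pow_succ, Matrix.mul_apply]
    exact Finset.sum_nonneg fun c _ => mul_nonneg (ih c) (edgeMatrix_nonneg hw c v)

lemma edgeMatrix_pow_height {w : Edge n → ℝ} {k : ℕ} {u v : Vertex n}
    (h : (edgeMatrix w ^ k) u v ≠ 0) : height v = height u + k := by
  induction k generalizing v with
  | zero =>
    rw [pow_zero, Matrix.one_apply] at h
    have : u = v := by by_contra hc; exact h (if_neg hc)
    rw [this, add_zero]
  | succ k ih =>
    rw [pow_succ, Matrix.mul_apply] at h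
    obtain ⟨c, -, hc⟩ := Finset.exists_ne_zero_of_sum_ne_zero h
    have h1 := ih (left_ne_zero_of_mul hc)
    have h2 : IsEdge c v := by
      by_contra h2
      exact right_ne_zero_of_mul hc (edgeMatrix_eq_zero w h2)
    rw [h2.height_eq, h1, add_assoc]

/-- A path of `k` steps from `u` meets only the levels from `height u` to `height u + k - 1`. All
later independence statements rest on this locality. -/
lemma edgeMatrix_pow_congr {w w' : Edge n → ℝ} {k : ℕ} {u v : Vertex n}
    (h : ∀ e : Edge n, height u ≤ e.level → e.level < height u + k → w e = w' e) :
    (edgeMatrix w ^ k) u v = (edgeMatrix w' ^ k) u v := by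
  induction k generalizing v with
  | zero => simp
  | succ k ih =>
    rw [pow_succ, pow_succ, Matrix.mul_apply, Matrix.mul_apply]
    refine Finset.sum_congr rfl fun c _ => ?_
    rw [ih fun e h1 h2 => h e h1 (by omega)]
    by_cases hc : (edgeMatrix w' ^ k) u c = 0
    · rw [hc, zero_mul, zero_mul]
    · congr 1
      rw [edgeMatrix, edgeMatrix]
      split_ifs with he
      · have := edgeMatrix_pow_height hc
        exact h _ (by rw [Edge.level_eq_height]; simp only; omega)
          (by rw [Edge.level_eq_height]; simp only; omega)
      · rfl

/-- The total weight of the paths of length `k` that start in the origin, by their endpoint. -/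
noncomputable def forwardMass (w : Edge n → ℝ) (k : ℕ) (v : Vertex n) : ℝ :=
  (edgeMatrix w ^ k) (origin n) v

lemma forwardMass_zero (w : Edge n → ℝ) (v : Vertex n) :
    forwardMass w 0 v = if origin n = v then 1 else 0 := by
  rw [forwardMass, pow_zero, Matrix.one_apply]

lemma forwardMass_succ (w : Edge n → ℝ) (k : ℕ) (v : Vertex n) :
    forwardMass w (k + 1) v = ∑ u, forwardMass w k u * edgeMatrix w u v := by
  rw [forwardMass, pow_succ, Matrix.mul_apply]
  rfl

lemma forwardMass_nonneg {w : Edge n → ℝ} (hw : ∀ e, 0 ≤ w e) (k : ℕ) (v : Vertex n) :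
    0 ≤ forwardMass w k v := edgeMatrix_pow_nonneg hw k _ v

lemma forwardMass_height {w : Edge n → ℝ} {k : ℕ} {v : Vertex n} (h : forwardMass w k v ≠ 0) :
    height v = k := by
  rw [edgeMatrix_pow_height h, height_origin, zero_add]

lemma forwardMass_congr {w w' : Edge n → ℝ} {k : ℕ}
    (h : ∀ e : Edge n, e.level < k → w e = w' e) (v : Vertex n) :
    forwardMass w k v = forwardMass w' k v :=
  edgeMatrix_pow_congr fun e _ he => h e (by rwa [height_origin, zero_add] at he)

/-- The total weight of the paths of length `k` that end in the target, by their first vertex. -/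
noncomputable def backwardMass (w : Edge n → ℝ) (k : ℕ) (v : Vertex n) : ℝ :=
  (edgeMatrix w ^ k) v (target n)

lemma backwardMass_congr {w w' : Edge n → ℝ} {k : ℕ}
    (h : ∀ e : Edge n, n - k ≤ e.level → w e = w' e) (v : Vertex n) :
    backwardMass w k v = backwardMass w' k v := by
  have key : height v + k = n → backwardMass w k v = backwardMass w' k v := fun hv =>
    edgeMatrix_pow_congr fun e he _ => h e (by omega)
  by_cases hv : height v + k = n
  · exact key hv
  -- At any other height no path of length `k` reaches the target, so the truncated `n - k` in the
  -- hypothesis does no harm.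
  · have h0 : ∀ w : Edge n → ℝ, backwardMass w k v = 0 := by
      intro w
      by_contra hc
      have := edgeMatrix_pow_height hc
      rw [height_target] at this
      exact hv this.symm
    rw [h0, h0]

lemma backwardMass_nonneg {w : Edge n → ℝ} (hw : ∀ e, 0 ≤ w e) (k : ℕ) (v : Vertex n) :
    0 ≤ backwardMass w k v := edgeMatrix_pow_nonneg hw k v _

/-- The total weight of the outer edges of the oriented paths is at most the product of the two
total masses, up to the number of possible inner parts. -/
lemma sum_prod_outer_le {r : ℕ} (hr : 2 * r ≤ n) {w : Edge n → ℝ} (hw : ∀ e, 0 ≤ w e) :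
    ∑ p : OrientedPath n, ∏ i ∈ outerSteps n r,
        w (OrientedPath.edge p i)
      ≤ (n - 2 * r).factorial * ((∑ u, forwardMass w r u) * ∑ v, backwardMass w r v) := by
  let f : ℕ → Matrix (Vertex n) (Vertex n) ℝ := fun i =>
    if i < r ∨ n - r ≤ i then edgeMatrix w else adjMatrix n
  have hf : ∀ i u v, ¬ IsEdge u v → f i u v = 0 := by
    intro i u v h
    simp only [f]
    split_ifs
    exacts [edgeMatrix_eq_zero w h, if_neg h]
  have h1 : ∀ p : OrientedPath n, ∏ i : Fin n, f i (p.1 i.castSucc) (p.1 i.succ)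
      = ∏ i ∈ outerSteps n r, w (OrientedPath.edge p i) := by
    intro p
    rw [Finset.prod_filter]
    refine Finset.prod_congr rfl fun i _ => ?_
    simp only [f]
    split_ifs
    · exact dif_pos (p.2.2.2 i)
    · exact if_pos (p.2.2.2 i)
  simp only [← h1]
  rw [sum_orientedPath_eq f hf]
  have h2 : ((List.range n).map f).prod
      = edgeMatrix w ^ r * adjMatrix n ^ (n - 2 * r) * edgeMatrix w ^ r := by
    -- The product over the steps splits into `r` weighted, `n - 2r` unweighted and `r` weighted
    -- factors.
    obtain ⟨m, hm⟩ : ∃ m, n = r + m + r := ⟨n - 2 * r, by omega⟩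
    have hm' : n - 2 * r = m := by omega
    have e0 : List.range n = List.range (r + m + r) := by rw [← hm]
    rw [hm', e0, List.range_add, List.range_add]
    simp only [List.map_append, List.prod_append, List.map_map]
    congr 1
    · congr 1
      · rw [List.map_congr_left (g := fun _ => edgeMatrix w), List.map_const', List.prod_replicate,
          List.length_range]
        intro i hi
        rw [List.mem_range] at hi
        exact if_pos (Or.inl hi)
      · rw [List.map_congr_left (g := fun _ => adjMatrix n), List.map_const', List.prod_replicate,
          List.length_range]
        intro i hi
        rw [List.mem_range] at hi
        exact if_neg (by dsimp only; omega)
    · rw [List.map_congr_left (g := fun _ => edgeMatrix w), List.map_const', List.prod_replicate,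
        List.length_range]
      intro i hi
      rw [List.mem_range] at hi
      exact if_pos (Or.inr (by dsimp only; omega))
  rw [h2, Matrix.mul_apply]
  calc ∑ v, (edgeMatrix w ^ r * adjMatrix n ^ (n - 2 * r)) (origin n) v
        * (edgeMatrix w ^ r) v (target n)
      ≤ ∑ v, ((n - 2 * r).factorial * ∑ u, forwardMass w r u) * backwardMass w r v := by
        refine Finset.sum_le_sum fun v _ => ?_
        refine mul_le_mul_of_nonneg_right ?_ (backwardMass_nonneg hw r v)
        rw [Matrix.mul_apply, Finset.mul_sum]
        refine Finset.sum_le_sum fun u _ => ?_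
        rw [mul_comm]
        refine mul_le_mul_of_nonneg_right ?_ (forwardMass_nonneg hw r u)
        -- The entry is `(n - 2r)!` or zero. Bounding the zero entries by `(n - 2r)!` too decouples
        -- the two endpoints; the loss is controlled later by comparing means.
        rw [adjMatrix_pow_apply]
        split_ifs
        · exact le_rfl
        · positivity
    _ = _ := by rw [← Finset.mul_sum, mul_assoc]

/-- The complement of a vertex. -/
def complVertex (u : Vertex n) : Vertex n := fun i => !u i

lemma complVertex_complVertex (u : Vertex n) : complVertex (complVertex u) = u := by
  ext i; simp [complVertex]

lemma IsEdge.compl {u v : Vertex n} (h : IsEdge u v) :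
    IsEdge (complVertex v) (complVertex u) := by
  obtain ⟨j, hj, rfl⟩ := h
  refine ⟨j, by simp [complVertex], ?_⟩
  ext i
  by_cases hi : i = j
  · subst hi; simp [complVertex, hj]
  · simp [complVertex, hi]

lemma isEdge_compl_iff {u v : Vertex n} :
    IsEdge (complVertex v) (complVertex u) ↔ IsEdge u v :=
  ⟨fun h => by simpa only [complVertex_complVertex] using h.compl, IsEdge.compl⟩

/-- Reversal of the edges of the hypercube. -/
def reverseEdge : Edge n ≃ Edge n where
  toFun e := ⟨(complVertex e.1.2, complVertex e.1.1), e.2.compl⟩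
  invFun e := ⟨(complVertex e.1.2, complVertex e.1.1), e.2.compl⟩
  left_inv e := by simp [complVertex_complVertex]
  right_inv e := by simp [complVertex_complVertex]

/-- Complementation as a permutation of the vertices. -/
def complEquiv : Vertex n ≃ Vertex n where
  toFun := complVertex
  invFun := complVertex
  left_inv := complVertex_complVertex
  right_inv := complVertex_complVertex

lemma edgeMatrix_reverse (w : Edge n → ℝ) (u v : Vertex n) :
    edgeMatrix w (complVertex v) (complVertex u) = edgeMatrix (fun e => w (reverseEdge e)) u v := by
  rw [edgeMatrix, edgeMatrix]
  by_cases h : IsEdge u v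
  · rw [dif_pos h, dif_pos h.compl]
    rfl
  · rw [dif_neg h, dif_neg fun h' => h (isEdge_compl_iff.1 h')]

lemma edgeMatrix_pow_reverse (w : Edge n → ℝ) (k : ℕ) (u v : Vertex n) :
    (edgeMatrix w ^ k) (complVertex v) (complVertex u)
      = (edgeMatrix (fun e => w (reverseEdge e)) ^ k) u v := by
  induction k generalizing v with
  | zero =>
    rw [pow_zero, pow_zero, Matrix.one_apply, Matrix.one_apply]
    refine if_congr ?_ rfl rfl
    rw [show (complVertex v = complVertex u) ↔ v = u from complEquiv.injective.eq_iff]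
    exact eq_comm
  | succ k ih =>
    rw [pow_succ', pow_succ, Matrix.mul_apply, Matrix.mul_apply, ← complEquiv.sum_comp]
    refine Finset.sum_congr rfl fun c _ => ?_
    rw [← ih, ← edgeMatrix_reverse, mul_comm]
    rfl

lemma sum_backwardMass_eq (w : Edge n → ℝ) (k : ℕ) :
    ∑ v, backwardMass w k v = ∑ v, forwardMass (fun e => w (reverseEdge e)) k v := by
  rw [← complEquiv.sum_comp]
  refine Finset.sum_congr rfl fun v _ => ?_
  rw [forwardMass, ← edgeMatrix_pow_reverse]
  rfl

end WeightMatrices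

/-! ### First and second moments of the total mass, and the cost of merging paths. -/

section Weights

variable {n : ℕ}

/-- The product of standard exponential laws on the edges. -/
noncomputable abbrev edgeLaw (n : ℕ) : Measure (Edge n → ℝ) := Measure.pi fun _ => expMeasure 1

/-- The Boltzmann weights of the edges. -/
noncomputable def boltzmann (x : Edge n → ℝ) : Edge n → ℝ := fun e => Real.exp (-(n * |x e|))

lemma boltzmann_nonneg (x : Edge n → ℝ) (e : Edge n) : 0 ≤ boltzmann x e := (Real.exp_pos _).le

lemma boltzmann_le_one (x : Edge n → ℝ) (e : Edge n) : boltzmann x e ≤ 1 :=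
  Real.exp_le_one_iff.2 (neg_nonpos.2 (by positivity))

@[fun_prop]
lemma continuous_boltzmann : Continuous (boltzmann (n := n)) := by
  unfold boltzmann
  fun_prop

@[fun_prop]
lemma continuous_edgeMatrix (u v : Vertex n) :
    Continuous fun w : Edge n → ℝ => edgeMatrix w u v := by
  unfold edgeMatrix
  split_ifs <;> fun_prop

@[fun_prop]
lemma continuous_edgeMatrix_pow (k : ℕ) (u v : Vertex n) :
    Continuous fun w : Edge n → ℝ => (edgeMatrix w ^ k) u v := by
  induction k generalizing v with
  | zero => simp only [pow_zero]; fun_prop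
  | succ k ih =>
    simp only [pow_succ, Matrix.mul_apply]
    fun_prop

@[fun_prop]
lemma continuous_forwardMass (k : ℕ) (v : Vertex n) :
    Continuous fun w : Edge n → ℝ => forwardMass w k v := continuous_edgeMatrix_pow k _ v

@[fun_prop]
lemma continuous_backwardMass (k : ℕ) (v : Vertex n) :
    Continuous fun w : Edge n → ℝ => backwardMass w k v := continuous_edgeMatrix_pow k v _

/-- The absolute value in `boltzmann` keeps the weights in `[0, 1]` for every sample, not only
almost surely, so a continuous function of them is bounded by compactness of the cube. -/
lemma integrable_comp_boltzmann {E : Type*} [NormedAddCommGroup E] {F : (Edge n → ℝ) → E}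
    (hF : Continuous F) : Integrable (fun x => F (boltzmann x)) (edgeLaw n) := by
  obtain ⟨C, hC⟩ := (isCompact_Icc (a := (0 : Edge n → ℝ)) (b := 1)).exists_bound_of_continuousOn
    hF.continuousOn
  refine .of_bound (hF.comp continuous_boltzmann).aestronglyMeasurable C
    (Eventually.of_forall fun x => hC _ ⟨fun e => boltzmann_nonneg x e, fun e => ?_⟩)
  exact boltzmann_le_one x e

/-- The masses of the vertices of height `k` are independent of the edges of level `k`. -/
lemma integral_forwardMass_eq {E : Type*} [NormedAddCommGroup E] [NormedSpace ℝ E] (k : ℕ)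
    {Φ : (Vertex n → ℝ) → (Edge n → ℝ) → E} (hΦ : Continuous fun q : _ × _ => Φ q.1 q.2)
    (hcongr : ∀ m : Vertex n → ℝ, (∀ u, m u ≠ 0 → height u = k) → ∀ w w' : Edge n → ℝ,
      (∀ e : Edge n, e.level = k → w e = w' e) → Φ m w = Φ m w') :
    ∫ z, Φ (forwardMass (boltzmann z) k) (boltzmann z) ∂(edgeLaw n)
      = ∫ x, ∫ y, Φ (forwardMass (boltzmann x) k) (boltzmann y) ∂(edgeLaw n) ∂(edgeLaw n) := by
  classical
  have hint := integrable_comp_boltzmann (n := n)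
    (F := fun w => Φ (forwardMass w k) w)
    (hΦ.comp (g := fun q : (Vertex n → ℝ) × (Edge n → ℝ) => Φ q.1 q.2)
      (f := fun w => (forwardMass w k, w))
      ((continuous_pi fun v => continuous_forwardMass k v).prodMk continuous_id))
  -- The masses at height `k` see only the levels below `k`, so all other edges can be resampled.
  rw [integral_pi_eq_integral_piecewise (expMeasure 1) {e : Edge n | e.level < k} hint]
  refine integral_congr_ae (Eventually.of_forall fun x => ?_)
  refine integral_congr_ae (Eventually.of_forall fun y => ?_)
  have h1 : forwardMass (boltzmann ({e : Edge n | e.level < k}.piecewise x y)) k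
      = forwardMass (boltzmann x) k := by
    ext v
    refine forwardMass_congr (fun e he => ?_) v
    simp only [boltzmann]
    rw [Set.piecewise_eq_of_mem _ _ _ (show e ∈ {e : Edge n | e.level < k} from he)]
  simp only [h1]
  refine hcongr _ (fun u hu => forwardMass_height hu) _ _ fun e he => ?_
  simp only [boltzmann]
  rw [Set.piecewise_eq_of_notMem _ _ _ (show e ∉ {e : Edge n | e.level < k} by simp [he])]

lemma integral_prod_exp_neg {θ : ℝ} (hθ : 0 ≤ θ) (T : Finset (Edge n)) :
    ∫ y, ∏ e ∈ T, Real.exp (-(θ * |y e|)) ∂(edgeLaw n) = (1 / (1 + θ)) ^ T.card := by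
  classical
  have h := integral_fintype_prod_eq_prod (𝕜 := ℝ) (μ := fun _ : Edge n => expMeasure 1)
    (fun e s => if e ∈ T then Real.exp (-(θ * |s|)) else 1)
  simp only [Fintype.prod_ite_mem] at h
  rw [h, ← Finset.prod_const, ← Fintype.prod_ite_mem T]
  refine Finset.prod_congr rfl fun e _ => ?_
  split_ifs
  · exact integral_exp_neg_mul_abs_expMeasure hθ
  · simp

lemma integral_boltzmann_prod (T : Finset (Edge n)) :
    ∫ y, ∏ e ∈ T, boltzmann y e ∂(edgeLaw n) = (1 / (1 + n)) ^ T.card :=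
  integral_prod_exp_neg (Nat.cast_nonneg n) T

/-- The mean of an entry of the weight matrix. -/
noncomputable def meanEntry (u v : Vertex n) : ℝ := if IsEdge u v then 1 / (1 + n) else 0

lemma meanEntry_nonneg (u v : Vertex n) : 0 ≤ meanEntry u v := by
  rw [meanEntry]; split_ifs <;> positivity

lemma meanEntry_le (u v : Vertex n) : meanEntry u v ≤ 1 / (1 + n) := by
  rw [meanEntry]; split_ifs
  · exact le_rfl
  · positivity

/-- A vertex has at most `n` outgoing edges of mean weight `1/(1+n)`, so mass does not grow in the
mean from one height to the next. -/
lemma sum_meanEntry_le_one (u : Vertex n) : ∑ v, meanEntry u v ≤ 1 := by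
  have h : ∀ v, meanEntry u v = (1 / (1 + n)) * if IsEdge u v then (1 : ℝ) else 0 := by
    intro v; rw [meanEntry]; split_ifs <;> simp
  simp only [h]
  rw [← Finset.mul_sum, card_isEdge_right, one_div, inv_mul_le_iff₀ (by positivity), mul_one]
  have : ((n - height u : ℕ) : ℝ) ≤ n := by exact_mod_cast Nat.sub_le _ _
  linarith

lemma integral_edgeMatrix (u v : Vertex n) :
    ∫ y, edgeMatrix (boltzmann y) u v ∂(edgeLaw n) = meanEntry u v := by
  by_cases h : IsEdge u v
  · have := integral_boltzmann_prod (n := n) {⟨(u, v), h⟩}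
    simp only [Finset.prod_singleton, Finset.card_singleton, pow_one] at this
    simp only [edgeMatrix, meanEntry, dif_pos h, if_pos h, this]
  · simp [edgeMatrix, meanEntry, h]

lemma integral_edgeMatrix_mul {u v u' v' : Vertex n} (hne : (u, v) ≠ (u', v')) :
    ∫ y, edgeMatrix (boltzmann y) u v * edgeMatrix (boltzmann y) u' v' ∂(edgeLaw n)
      = meanEntry u v * meanEntry u' v' := by
  by_cases h : IsEdge u v
  · by_cases h' : IsEdge u' v'
    · have hne' : (⟨(u, v), h⟩ : Edge n) ≠ ⟨(u', v'), h'⟩ := fun hc => hne (congrArg (·.1) hc)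
      have := integral_boltzmann_prod (n := n) {⟨(u, v), h⟩, ⟨(u', v'), h'⟩}
      simp only [Finset.prod_pair hne', Finset.card_pair hne'] at this
      simp only [edgeMatrix, meanEntry, dif_pos h, if_pos h, dif_pos h', if_pos h', this]
      ring
    · simp [edgeMatrix, meanEntry, h']
  · simp [edgeMatrix, meanEntry, h]

lemma integral_edgeMatrix_sq_le (u v : Vertex n) :
    ∫ y, edgeMatrix (boltzmann y) u v * edgeMatrix (boltzmann y) u v ∂(edgeLaw n)
      ≤ meanEntry u v := by
  rw [← integral_edgeMatrix]
  refine integral_mono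
    (integrable_comp_boltzmann (F := fun w => edgeMatrix w u v * edgeMatrix w u v) (by fun_prop))
    (integrable_comp_boltzmann (F := fun w => edgeMatrix w u v) (by fun_prop)) fun y => ?_
  have h0 := edgeMatrix_nonneg (boltzmann_nonneg y) u v
  refine mul_le_of_le_one_right h0 ?_
  rw [edgeMatrix]
  split_ifs
  · exact boltzmann_le_one y _
  · exact zero_le_one

lemma edgeMatrix_congr_of_height {k : ℕ} {u : Vertex n} (hu : height u = k) {w w' : Edge n → ℝ}
    (h : ∀ e : Edge n, e.level = k → w e = w' e) (v : Vertex n) :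
    edgeMatrix w u v = edgeMatrix w' u v := by
  rw [edgeMatrix, edgeMatrix]
  split_ifs with he
  · exact h _ (by rw [Edge.level_eq_height]; exact hu)
  · rfl

lemma mul_edgeMatrix_congr {k : ℕ} {m : Vertex n → ℝ} (hm : ∀ u, m u ≠ 0 → height u = k)
    {w w' : Edge n → ℝ} (h : ∀ e : Edge n, e.level = k → w e = w' e) (u v : Vertex n) :
    m u * edgeMatrix w u v = m u * edgeMatrix w' u v := by
  by_cases hu : m u = 0
  · rw [hu, zero_mul, zero_mul]
  · rw [edgeMatrix_congr_of_height (hm u hu) h]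

/-- The total mass at height `k`. -/
noncomputable def totalMass (k : ℕ) (x : Edge n → ℝ) : ℝ := ∑ u, forwardMass (boltzmann x) k u

lemma totalMass_nonneg (k : ℕ) (x : Edge n → ℝ) : 0 ≤ totalMass k x :=
  Finset.sum_nonneg fun u _ => forwardMass_nonneg (boltzmann_nonneg x) k u

lemma totalMass_zero (x : Edge n → ℝ) : totalMass 0 x = 1 := by
  simp [totalMass, forwardMass_zero]

lemma continuous_totalMass (k : ℕ) : Continuous (totalMass (n := n) k) := by
  unfold totalMass
  fun_prop

lemma integrable_totalMass (k : ℕ) : Integrable (totalMass k) (edgeLaw n) :=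
  integrable_comp_boltzmann (F := fun w => ∑ u, forwardMass w k u) (by fun_prop)

lemma integrable_totalMass_sq (k : ℕ) :
    Integrable (fun x => totalMass k x ^ 2) (edgeLaw n) :=
  integrable_comp_boltzmann (F := fun w => (∑ u, forwardMass w k u) ^ 2) (by fun_prop)

lemma integral_sum_mul_edgeMatrix_le {m : Vertex n → ℝ} (hm : ∀ u, 0 ≤ m u) :
    ∫ y, ∑ v, ∑ u, m u * edgeMatrix (boltzmann y) u v ∂(edgeLaw n) ≤ ∑ u, m u := by
  have hi : ∀ u v : Vertex n,
      Integrable (fun y => m u * edgeMatrix (boltzmann y) u v) (edgeLaw n) := fun u v =>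
    integrable_comp_boltzmann (F := fun w => m u * edgeMatrix w u v) (by fun_prop)
  rw [integral_finsetSum _ fun v _ => integrable_finsetSum _ fun u _ => hi u v]
  simp only [integral_finsetSum _ fun u _ => hi u _, integral_const_mul, integral_edgeMatrix]
  rw [Finset.sum_comm]
  refine Finset.sum_le_sum fun u _ => ?_
  rw [← Finset.mul_sum]
  exact mul_le_of_le_one_right (hm u) (sum_meanEntry_le_one u)

lemma integral_totalMass_le_one (k : ℕ) : ∫ x, totalMass k x ∂(edgeLaw n) ≤ 1 := by
  induction k with
  | zero => simp [totalMass_zero]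
  | succ k ih =>
    refine le_trans ?_ ih
    have h := integral_forwardMass_eq (n := n) k
      (Φ := fun m w => ∑ v, ∑ u, m u * edgeMatrix w u v) (by fun_prop)
      (fun m hm w w' hw => Finset.sum_congr rfl fun v _ => Finset.sum_congr rfl fun u _ =>
        mul_edgeMatrix_congr hm hw u v)
    simp only [totalMass, forwardMass_succ]
    rw [h]
    refine integral_mono_of_nonneg (Eventually.of_forall fun x => ?_) (integrable_totalMass k)
      (Eventually.of_forall fun x =>
        integral_sum_mul_edgeMatrix_le fun u => forwardMass_nonneg (boltzmann_nonneg x) k u)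
    exact integral_nonneg fun y => Finset.sum_nonneg fun v _ => Finset.sum_nonneg fun u _ =>
      mul_nonneg (forwardMass_nonneg (boltzmann_nonneg x) k u)
        (edgeMatrix_nonneg (boltzmann_nonneg y) u v)

/-- Expand the square over pairs of edges. Pairs of different edges are uncorrelated and give at
most the squared mass; the diagonal gives at most `∑ m u ^ 2`, because squares of weights in `[0,
1]` are below the weights. Each is at most `(∑ m u) ^ 2`, whence the `2`. -/
lemma integral_sum_mul_edgeMatrix_sq_le {m : Vertex n → ℝ} (hm : ∀ u, 0 ≤ m u) :
    ∫ y, (∑ v, ∑ u, m u * edgeMatrix (boltzmann y) u v) ^ 2 ∂(edgeLaw n)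
      ≤ 2 * (∑ u, m u) ^ 2 := by
  have hi : ∀ p q : Vertex n × Vertex n, Integrable (fun y => m p.2 * m q.2 *
      (edgeMatrix (boltzmann y) p.2 p.1 * edgeMatrix (boltzmann y) q.2 q.1)) (edgeLaw n) :=
    fun p q => integrable_comp_boltzmann (F := fun w => m p.2 * m q.2 *
      (edgeMatrix w p.2 p.1 * edgeMatrix w q.2 q.1)) (by fun_prop)
  have h1 : ∀ y : Edge n → ℝ, (∑ v, ∑ u, m u * edgeMatrix (boltzmann y) u v) ^ 2
      = ∑ p : Vertex n × Vertex n, ∑ q : Vertex n × Vertex n, m p.2 * m q.2 *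
      (edgeMatrix (boltzmann y) p.2 p.1 * edgeMatrix (boltzmann y) q.2 q.1) := by
    intro y
    rw [← Fintype.sum_prod_type', sq, Finset.sum_mul_sum]
    exact Finset.sum_congr rfl fun p _ => Finset.sum_congr rfl fun q _ => by ring
  simp only [h1]
  rw [integral_finsetSum _ fun p _ => integrable_finsetSum _ fun q _ => hi p q]
  simp only [integral_finsetSum _ fun q _ => hi _ q, integral_const_mul]
  have h2 : ∀ p q : Vertex n × Vertex n, m p.2 * m q.2 *
      ∫ y, edgeMatrix (boltzmann y) p.2 p.1 * edgeMatrix (boltzmann y) q.2 q.1 ∂(edgeLaw n)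
      ≤ (m p.2 * meanEntry p.2 p.1) * (m q.2 * meanEntry q.2 q.1)
        + if p = q then m p.2 ^ 2 * meanEntry p.2 p.1 else 0 := by
    intro p q
    by_cases hpq : p = q
    · subst hpq
      rw [if_pos rfl]
      have := mul_le_mul_of_nonneg_left (integral_edgeMatrix_sq_le p.2 p.1)
        (mul_nonneg (hm p.2) (hm p.2))
      have h3 := mul_self_nonneg (m p.2 * meanEntry p.2 p.1)
      linarith
    · rw [if_neg hpq, integral_edgeMatrix_mul fun hc => hpq (Prod.ext (congrArg Prod.snd hc)
        (congrArg Prod.fst hc))]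
      exact le_of_eq (by ring)
  refine (Finset.sum_le_sum fun p _ => Finset.sum_le_sum fun q _ => h2 p q).trans ?_
  simp only [Finset.sum_add_distrib, Finset.sum_ite_eq, Finset.mem_univ, if_true]
  rw [← Finset.sum_mul_sum, two_mul]
  have h4 : ∑ p : Vertex n × Vertex n, m p.2 * meanEntry p.2 p.1 ≤ ∑ u, m u := by
    rw [Fintype.sum_prod_type_right]
    refine Finset.sum_le_sum fun u _ => ?_
    dsimp only
    rw [← Finset.mul_sum]
    exact mul_le_of_le_one_right (hm u) (sum_meanEntry_le_one u)
  have h5 : ∑ p : Vertex n × Vertex n, m p.2 ^ 2 * meanEntry p.2 p.1 ≤ ∑ u, m u ^ 2 := by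
    rw [Fintype.sum_prod_type_right]
    refine Finset.sum_le_sum fun u _ => ?_
    dsimp only
    rw [← Finset.mul_sum]
    exact mul_le_of_le_one_right (sq_nonneg _) (sum_meanEntry_le_one u)
  have h6 : 0 ≤ ∑ p : Vertex n × Vertex n, m p.2 * meanEntry p.2 p.1 :=
    Finset.sum_nonneg fun p _ => mul_nonneg (hm _) (meanEntry_nonneg _ _)
  have h7 : ∑ u, m u ^ 2 ≤ (∑ u, m u) ^ 2 := by
    rw [sq (∑ u, m u), Finset.sum_mul]
    refine Finset.sum_le_sum fun u _ => ?_
    rw [sq]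
    exact mul_le_mul_of_nonneg_left
      (Finset.single_le_sum (fun u _ => hm u) (Finset.mem_univ u)) (hm u)
  have h8 := mul_le_mul h4 h4 h6 (h6.trans h4)
  nlinarith

lemma integral_totalMass_sq_le (k : ℕ) : ∫ x, totalMass k x ^ 2 ∂(edgeLaw n) ≤ 2 ^ k := by
  induction k with
  | zero => simp [totalMass_zero]
  | succ k ih =>
    have h := integral_forwardMass_eq (n := n) k
      (Φ := fun m w => (∑ v, ∑ u, m u * edgeMatrix w u v) ^ 2) (by fun_prop)
      (fun m hm w w' hw => congrArg (· ^ 2) <| Finset.sum_congr rfl fun v _ =>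
        Finset.sum_congr rfl fun u _ => mul_edgeMatrix_congr hm hw u v)
    simp only [totalMass, forwardMass_succ]
    rw [h, pow_succ, mul_comm]
    refine le_trans ?_ (mul_le_mul_of_nonneg_left ih zero_le_two)
    rw [← integral_const_mul]
    exact integral_mono_of_nonneg (Eventually.of_forall fun x => integral_nonneg fun y =>
      sq_nonneg _) ((integrable_totalMass_sq k).const_mul 2)
      (Eventually.of_forall fun x =>
        integral_sum_mul_edgeMatrix_sq_le fun u => forwardMass_nonneg (boltzmann_nonneg x) k u)

/-- The contribution of the pairs of different edges with a common endpoint is small. -/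
lemma integral_sum_collision_le {m : Vertex n → ℝ} (hm : ∀ u, 0 ≤ m u) :
    ∫ y, ∑ v, ((∑ u, m u * edgeMatrix (boltzmann y) u v) ^ 2
      - ∑ u, (m u * edgeMatrix (boltzmann y) u v) ^ 2) ∂(edgeLaw n)
      ≤ (∑ u, m u) ^ 2 / (1 + n) := by
  have h0 : ∀ (y : Edge n → ℝ) v, (∑ u, m u * edgeMatrix (boltzmann y) u v) ^ 2
      - ∑ u, (m u * edgeMatrix (boltzmann y) u v) ^ 2
      = ∑ u, ∑ u', if u = u' then 0 else m u * m u' *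
        (edgeMatrix (boltzmann y) u v * edgeMatrix (boltzmann y) u' v) := by
    intro y v
    rw [sq, Finset.sum_mul_sum, ← Finset.sum_sub_distrib]
    refine Finset.sum_congr rfl fun u _ => ?_
    rw [sub_eq_iff_eq_add, ← Finset.sum_erase_add _ _ (Finset.mem_univ u),
      ← Finset.sum_erase_add (a := u) (f := fun u' => ite _ _ _) _ (Finset.mem_univ u)]
    rw [if_pos rfl, add_zero, sq]
    congr 1
    refine Finset.sum_congr rfl fun u' hu' => ?_
    rw [if_neg (Finset.ne_of_mem_erase hu').symm]
    ring
  have hi : ∀ v u u' : Vertex n, Integrable (fun y => if u = u' then 0 else m u * m u' *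
      (edgeMatrix (boltzmann y) u v * edgeMatrix (boltzmann y) u' v)) (edgeLaw n) := by
    intro v u u'
    split_ifs
    · exact integrable_zero _ _ _
    · exact integrable_comp_boltzmann (F := fun w => m u * m u' *
        (edgeMatrix w u v * edgeMatrix w u' v)) (by fun_prop)
  simp only [h0]
  rw [integral_finsetSum _ fun v _ => integrable_finsetSum _ fun u _ =>
    integrable_finsetSum _ fun u' _ => hi v u u']
  simp only [integral_finsetSum _ fun u _ => integrable_finsetSum _ fun u' _ => hi _ u u',
    integral_finsetSum _ fun u' _ => hi _ _ u']
  have h2 : ∀ v u u' : Vertex n, ∫ y, (if u = u' then 0 else m u * m u' *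
      (edgeMatrix (boltzmann y) u v * edgeMatrix (boltzmann y) u' v)) ∂(edgeLaw n)
      ≤ m u * m u' * (1 / (1 + n)) * meanEntry u v := by
    intro v u u'
    have hb := meanEntry_nonneg u v
    have hmm := mul_nonneg (hm u) (hm u')
    by_cases huu : u = u'
    · simp only [if_pos huu, integral_zero]
      positivity
    · simp only [if_neg huu, integral_const_mul]
      rw [integral_edgeMatrix_mul fun hc => huu (congrArg Prod.fst hc), mul_assoc (m u * m u'),
        mul_comm (1 / (1 + (n : ℝ)))]
      exact mul_le_mul_of_nonneg_left
        (mul_le_mul_of_nonneg_left (meanEntry_le u' v) hb) hmm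
  refine (Finset.sum_le_sum fun v _ => Finset.sum_le_sum fun u _ =>
    Finset.sum_le_sum fun u' _ => h2 v u u').trans ?_
  rw [Finset.sum_comm, div_eq_mul_one_div ((∑ u, m u) ^ 2), sq, Finset.sum_mul_sum, Finset.sum_mul]
  refine Finset.sum_le_sum fun u _ => ?_
  rw [Finset.sum_comm, Finset.sum_mul]
  refine Finset.sum_le_sum fun u' _ => ?_
  rw [← Finset.mul_sum]
  exact mul_le_of_le_one_right (mul_nonneg (mul_nonneg (hm u) (hm u')) (by positivity))
    (sum_meanEntry_le_one u)

end Weights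

/-! ### Poisson approximation: the mass on the cube follows the branching recursion up to `O(1/n)`.
-/

section CharacteristicFunctionOfMass

open Set Topology

lemma norm_prod_sub_prod_le {ι : Type*} (s : Finset ι) {a b : ι → ℂ}
    (ha : ∀ i ∈ s, ‖a i‖ ≤ 1) (hb : ∀ i ∈ s, ‖b i‖ ≤ 1) :
    ‖∏ i ∈ s, a i - ∏ i ∈ s, b i‖ ≤ ∑ i ∈ s, ‖a i - b i‖ := by
  classical
  induction s using Finset.induction_on with
  | empty => simp
  | insert j s hj ih =>
    have ih := ih (fun i hi => ha i (Finset.mem_insert_of_mem hi))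
      fun i hi => hb i (Finset.mem_insert_of_mem hi)
    rw [Finset.prod_insert hj, Finset.prod_insert hj, Finset.sum_insert hj]
    have hbs : ‖∏ i ∈ s, b i‖ ≤ 1 := by
      rw [norm_prod]
      exact Finset.prod_le_one (fun i _ => norm_nonneg _)
        fun i hi => hb i (Finset.mem_insert_of_mem hi)
    calc ‖a j * ∏ i ∈ s, a i - b j * ∏ i ∈ s, b i‖
        = ‖(a j - b j) * ∏ i ∈ s, b i + a j * (∏ i ∈ s, a i - ∏ i ∈ s, b i)‖ := by
          congr 1; ring
      _ ≤ ‖a j - b j‖ * ‖∏ i ∈ s, b i‖ + ‖a j‖ * ‖∏ i ∈ s, a i - ∏ i ∈ s, b i‖ := by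
          rw [← norm_mul, ← norm_mul]; exact norm_add_le _ _
      _ ≤ ‖a j - b j‖ * 1 + 1 * ∑ i ∈ s, ‖a i - b i‖ := by
          gcongr
          exact ha j (Finset.mem_insert_self j s)
      _ = _ := by ring

lemma norm_pow_sub_pow_le {a b : ℂ} (ha : ‖a‖ ≤ 1) (hb : ‖b‖ ≤ 1) (N : ℕ) :
    ‖a ^ N - b ^ N‖ ≤ N * ‖a - b‖ := by
  have := norm_prod_sub_prod_le (Finset.range N) (a := fun _ => a) (b := fun _ => b)
    (fun _ _ => ha) fun _ _ => hb
  simpa using this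

lemma norm_exp_neg_sub_one_sub_le {z : ℂ} (hz : 0 ≤ z.re) :
    ‖Complex.exp (-z) - (1 - z)‖ ≤ 3 * ‖z‖ ^ 2 := by
  rcases le_total ‖z‖ 1 with h | h
  · have := Complex.norm_exp_sub_one_sub_id_le (x := -z) (by rwa [norm_neg])
    rw [norm_neg] at this
    calc ‖Complex.exp (-z) - (1 - z)‖ = ‖Complex.exp (-z) - 1 - -z‖ := by congr 1; ring
      _ ≤ ‖z‖ ^ 2 := this
      _ ≤ 3 * ‖z‖ ^ 2 := by nlinarith [sq_nonneg ‖z‖]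
  · have h1 : ‖Complex.exp (-z)‖ ≤ 1 := by
      rw [Complex.norm_exp]
      simpa using hz
    calc ‖Complex.exp (-z) - (1 - z)‖ ≤ ‖Complex.exp (-z)‖ + (‖(1 : ℂ)‖ + ‖z‖) :=
          (norm_sub_le _ _).trans (by gcongr; exact norm_sub_le _ _)
      _ ≤ 1 + (1 + ‖z‖) := by rw [norm_one]; gcongr
      _ ≤ 3 * ‖z‖ ^ 2 := by nlinarith

/-- The mean of `g` of a mass transported along one edge. -/
noncomputable def edgeTransform (n : ℕ) (g : ℝ → ℂ) (m : ℝ) : ℂ :=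
  ∫ s, g (m * Real.exp (-(n * |s|))) ∂(expMeasure 1)

namespace IsNearlyMultiplicative

variable {g : ℝ → ℂ}

lemma norm_edgeTransform_le_one (hg : IsNearlyMultiplicative g) (n : ℕ) (m : ℝ) :
    ‖edgeTransform n g m‖ ≤ 1 := by
  refine (norm_integral_le_of_norm_le_const (Eventually.of_forall fun s =>
    hg.norm_le_one _)).trans_eq ?_
  simp

/-- Replacing the exponential density `e^{-s}` by `1` and rescaling by `n` turns one edge into `1/n`
of the Poisson exponent. The error is at most `|m| ∫ (1 - e^{-s}) e^{-ns} ds = |m| (1/n - 1/(n+1))`.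
-/
lemma norm_edgeTransform_sub_le (hg : IsNearlyMultiplicative g) {n : ℕ} (hn : 0 < n) (m : ℝ) :
    ‖edgeTransform n g m - (1 - poissonExponent g m / n)‖ ≤ |m| / n ^ 2 := by
  have hn' : (0 : ℝ) < n := by exact_mod_cast hn
  have hc := hg.continuous
  have hexp : ∀ a : ℝ, 0 < a → IntegrableOn (fun s => Real.exp (-(a * s))) (Ioi 0) := by
    intro a ha
    simpa using integrableOn_exp_mul_Ioi (neg_lt_zero.2 ha) 0
  have hexpi : ∀ a : ℝ, 0 < a → ∫ s in Ioi (0 : ℝ), Real.exp (-(a * s)) = 1 / a := by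
    intro a ha
    have := integral_exp_mul_Ioi (neg_lt_zero.2 ha) 0
    simp only [neg_mul, mul_zero, Real.exp_zero, neg_div_neg_eq] at this
    exact this
  have hq : ∀ s : ℝ, ‖1 - g (m * Real.exp (-(n * s)))‖ ≤ |m| * Real.exp (-(n * s)) := fun s =>
    (hg.norm_one_sub_le _).trans_eq (by rw [abs_mul, abs_of_pos (Real.exp_pos _)])
  have hqi : IntegrableOn (fun s : ℝ => 1 - g (m * Real.exp (-(n * s)))) (Ioi 0) :=
    Integrable.mono' ((hexp n hn').const_mul |m|) (by fun_prop) (Eventually.of_forall hq)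
  have hpi : IntegrableOn (fun s : ℝ => Real.exp (-s) • (1 - g (m * Real.exp (-(n * s)))))
      (Ioi 0) := by
    refine Integrable.mono' ((hexp n hn').const_mul |m|) (by fun_prop)
      ((ae_restrict_iff' measurableSet_Ioi).2 (Eventually.of_forall fun s hs => ?_))
    rw [norm_smul, Real.norm_eq_abs, abs_of_pos (Real.exp_pos _)]
    refine (mul_le_of_le_one_left (norm_nonneg _) ?_).trans (hq s)
    have hs : 0 < s := hs
    exact Real.exp_le_one_iff.2 (by linarith)
  have h1 : poissonExponent g m / n = ∫ s in Ioi (0 : ℝ), (1 - g (m * Real.exp (-(n * s)))) := by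
    have := integral_comp_mul_left_Ioi (fun s => 1 - g (m * Real.exp (-s))) 0 hn'
    rw [this, mul_zero, poissonExponent, Complex.real_smul, Complex.ofReal_inv,
      Complex.ofReal_natCast]
    exact div_eq_inv_mul _ _
  have h2 : 1 - edgeTransform n g m
      = ∫ s in Ioi (0 : ℝ), Real.exp (-s) • (1 - g (m * Real.exp (-(n * s)))) := by
    have h3 : 1 - edgeTransform n g m
        = ∫ s, (1 - g (m * Real.exp (-(n * |s|)))) ∂(expMeasure 1) := by
      rw [integral_sub (integrable_const _), edgeTransform]
      · simp
      · exact .of_bound (by fun_prop) 1 (Eventually.of_forall fun s => hg.norm_le_one _)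
    rw [h3, integral_expMeasure_one]
    refine setIntegral_congr_fun measurableSet_Ioi fun s hs => ?_
    simp only [abs_of_pos (show 0 < s from hs)]
  have h4 : edgeTransform n g m - (1 - poissonExponent g m / n)
      = ∫ s in Ioi (0 : ℝ), ((1 - g (m * Real.exp (-(n * s))))
        - Real.exp (-s) • (1 - g (m * Real.exp (-(n * s))))) := by
    rw [integral_sub hqi hpi, ← h1, ← h2]
    ring
  rw [h4]
  have hb : IntegrableOn (fun s : ℝ => |m| * (Real.exp (-(n * s)) - Real.exp (-((n + 1) * s))))
      (Ioi 0) := ((hexp n hn').sub (hexp (n + 1) (by positivity))).const_mul |m|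
  calc _ ≤ ∫ s in Ioi (0 : ℝ), |m| * (Real.exp (-(n * s)) - Real.exp (-((n + 1) * s))) := by
        refine norm_integral_le_of_norm_le hb
          ((ae_restrict_iff' measurableSet_Ioi).2 (Eventually.of_forall fun s hs => ?_))
        have hs : 0 < s := hs
        have he : Real.exp (-s) ≤ 1 := Real.exp_le_one_iff.2 (by linarith)
        have h5 : (1 - g (m * Real.exp (-(n * s))))
            - Real.exp (-s) • (1 - g (m * Real.exp (-(n * s))))
            = (1 - Real.exp (-s)) • (1 - g (m * Real.exp (-(n * s)))) := by
          rw [sub_smul, one_smul]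
        rw [h5, norm_smul, Real.norm_eq_abs, abs_of_nonneg (by linarith)]
        refine (mul_le_mul_of_nonneg_left (hq s) (by linarith)).trans_eq ?_
        rw [show -((n + 1 : ℝ) * s) = -(n * s) + -s by ring, Real.exp_add]
        ring
    _ = |m| * (1 / n - 1 / (n + 1)) := by
        rw [integral_const_mul, integral_sub (hexp n hn') (hexp (n + 1) (by positivity)),
          hexpi n hn', hexpi (n + 1) (by positivity)]
    _ ≤ |m| / n ^ 2 := by
        rw [div_eq_mul_one_div |m|]
        refine mul_le_mul_of_nonneg_left ?_ (abs_nonneg m)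
        rw [div_sub_div _ _ hn'.ne' (by positivity), div_le_div_iff₀ (by positivity)
          (by positivity)]
        nlinarith

/-- Quantitative form of `(1 - G/n)^n → e^{-G}`, for the `n - k` edges leaving a vertex of height
`k`. The `k` missing factors are each within `|m|/n` of `1`. -/
lemma norm_edgeTransform_pow_sub_le (hg : IsNearlyMultiplicative g) {n k : ℕ} (hn : 0 < n)
    (hk : k ≤ n) (m : ℝ) :
    ‖edgeTransform n g m ^ (n - k) - Complex.exp (-poissonExponent g m)‖
      ≤ ((k + 1) * |m| + 3 * m ^ 2) / n := by
  have hn' : (0 : ℝ) < n := by exact_mod_cast hn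
  set G := poissonExponent g m with hG
  have hG0 : 0 ≤ G.re := hg.re_poissonExponent_nonneg m
  have hGm : ‖G‖ ≤ |m| := hg.norm_poissonExponent_le m
  have hre : 0 ≤ (G / n).re := by
    rw [Complex.div_natCast_re]; positivity
  have hnorm : ‖G / n‖ ≤ |m| / n := by
    rw [norm_div, Complex.norm_natCast]
    gcongr
  set a := Complex.exp (-(G / n)) with ha
  have ha1 : ‖a‖ ≤ 1 := by
    rw [ha, Complex.norm_exp]
    simpa using hre
  have h1 : ‖edgeTransform n g m - a‖ ≤ (|m| + 3 * m ^ 2) / n ^ 2 := by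
    calc ‖edgeTransform n g m - a‖
        = ‖(edgeTransform n g m - (1 - G / n)) - (a - (1 - G / n))‖ := by congr 1; ring
      _ ≤ |m| / n ^ 2 + 3 * (|m| / n) ^ 2 := by
          refine (norm_sub_le _ _).trans (add_le_add (hg.norm_edgeTransform_sub_le hn m) ?_)
          refine (norm_exp_neg_sub_one_sub_le hre).trans ?_
          gcongr
      _ = (|m| + 3 * m ^ 2) / n ^ 2 := by rw [div_pow, sq_abs]; ring
  have h2 : ‖edgeTransform n g m ^ (n - k) - a ^ (n - k)‖ ≤ (|m| + 3 * m ^ 2) / n := by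
    refine (norm_pow_sub_pow_le (hg.norm_edgeTransform_le_one n m) ha1 _).trans ?_
    have h3 : ((n - k : ℕ) : ℝ) ≤ n := by exact_mod_cast Nat.sub_le _ _
    calc _ ≤ (n : ℝ) * ((|m| + 3 * m ^ 2) / n ^ 2) := by gcongr
      _ = (|m| + 3 * m ^ 2) / n := by field_simp
  have h3 : Complex.exp (-G) = a ^ (n - k) * a ^ k := by
    rw [← pow_add, Nat.sub_add_cancel hk, ha, ← Complex.exp_nat_mul]
    congr 1
    have : (n : ℂ) ≠ 0 := by exact_mod_cast hn.ne'
    field_simp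
  have h4 : ‖a ^ (n - k) - Complex.exp (-G)‖ ≤ k * |m| / n := by
    rw [h3, ← mul_one_sub, norm_mul, norm_pow]
    refine (mul_le_of_le_one_left (norm_nonneg _) (pow_le_one₀ (norm_nonneg _) ha1)).trans ?_
    have h5 := norm_pow_sub_pow_le (a := 1) norm_one.le ha1 k
    rw [one_pow] at h5
    refine h5.trans ?_
    have h6 := norm_exp_neg_sub_exp_neg_le (a := 0) le_rfl hre
    rw [neg_zero, Complex.exp_zero, zero_sub, norm_neg] at h6
    rw [mul_div_assoc]
    gcongr
    exact h6.trans hnorm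
  calc _ ≤ ‖edgeTransform n g m ^ (n - k) - a ^ (n - k)‖ + ‖a ^ (n - k) - Complex.exp (-G)‖ :=
        norm_sub_le_norm_sub_add_norm_sub _ _ _
    _ ≤ (|m| + 3 * m ^ 2) / n + k * |m| / n := add_le_add h2 h4
    _ = _ := by ring

lemma edgeTransform_zero (hg : IsNearlyMultiplicative g) (n : ℕ) : edgeTransform n g 0 = 1 := by
  simp [edgeTransform, hg.map_zero]

end IsNearlyMultiplicative

variable {n : ℕ}

lemma prod_edge_eq {M : Type*} [CommMonoid M] {F : Vertex n → Vertex n → M}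
    (hF : ∀ u v, ¬ IsEdge u v → F u v = 1) :
    ∏ v, ∏ u, F u v = ∏ e : Edge n, F e.1.1 e.1.2 := by
  rw [Finset.prod_comm, ← Fintype.prod_prod_type']
  rw [← Finset.prod_subtype (Finset.univ.filter fun q : Vertex n × Vertex n => IsEdge q.1 q.2)
    (by simp) (fun q => F q.1 q.2), Finset.prod_filter]
  refine Finset.prod_congr rfl fun q _ => ?_
  split_ifs with h
  · rfl
  · exact hF _ _ h

/-- Once `g` is applied to each edge separately, independence factorizes the mean; non-edges
contribute `g 0 = 1`. -/
lemma integral_prod_edge_eq {g : ℝ → ℂ} (hg : IsNearlyMultiplicative g) (t : ℝ)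
    (m : Vertex n → ℝ) :
    ∫ y, ∏ v, ∏ u, g (t * (m u * edgeMatrix (boltzmann y) u v)) ∂(edgeLaw n)
      = ∏ u, edgeTransform n g (t * m u) ^ (n - height u) := by
  have h1 : ∀ y : Edge n → ℝ, ∏ v, ∏ u, g (t * (m u * edgeMatrix (boltzmann y) u v))
      = ∏ e : Edge n, g (t * m e.1.1 * Real.exp (-(n * |y e|))) := by
    intro y
    rw [prod_edge_eq fun u v h => by rw [edgeMatrix_eq_zero _ h, mul_zero, mul_zero, hg.map_zero]]
    refine Finset.prod_congr rfl fun e _ => ?_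
    rw [edgeMatrix, dif_pos e.2, ← mul_assoc]
    rfl
  simp only [h1]
  rw [integral_fintype_prod_eq_prod (𝕜 := ℂ) (μ := fun _ : Edge n => expMeasure 1)
    (fun e s => g (t * m e.1.1 * Real.exp (-(n * |s|))))]
  have h2 := prod_edge_eq (n := n)
    (F := fun u v => if IsEdge u v then edgeTransform n g (t * m u) else 1)
    (fun u v h => if_neg h)
  have h3 : ∀ e : Edge n, (if IsEdge e.1.1 e.1.2 then edgeTransform n g (t * m e.1.1) else 1)
      = ∫ s, g (t * m e.1.1 * Real.exp (-(n * |s|))) ∂(expMeasure 1) := fun e => if_pos e.2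
  simp only [h3] at h2
  rw [← h2, Finset.prod_comm]
  refine Finset.prod_congr rfl fun u _ => ?_
  rw [← Finset.prod_filter, Finset.prod_const]
  congr 1
  have := card_isEdge_right u
  rw [Finset.sum_boole] at this
  exact_mod_cast this

/-- Two errors of order `1/n` add up: `h1` treats edges that enter the same vertex as if they
entered different ones, and `h2` is the Poisson approximation of the edges leaving each vertex. -/
lemma norm_integral_prod_sub_le {g : ℝ → ℂ} (hg : IsNearlyMultiplicative g) (hn : 0 < n)
    (t : ℝ) {k : ℕ} {m : Vertex n → ℝ} (hm : ∀ u, 0 ≤ m u)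
    (hmk : ∀ u, m u ≠ 0 → height u = k) :
    ‖∫ y, ∏ v, g (t * ∑ u, m u * edgeMatrix (boltzmann y) u v) ∂(edgeLaw n)
      - ∏ u, Complex.exp (-poissonExponent g (t * m u))‖
      ≤ ((k + 1) * |t| * ∑ u, m u + 4 * t ^ 2 * (∑ u, m u) ^ 2) / n := by
  have hn' : (0 : ℝ) < n := by exact_mod_cast hn
  have hc := hg.continuous
  have hS : 0 ≤ ∑ u, m u := Finset.sum_nonneg fun u _ => hm u
  have hS2 : ∑ u, m u ^ 2 ≤ (∑ u, m u) ^ 2 := by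
    rw [sq (∑ u, m u), Finset.sum_mul]
    refine Finset.sum_le_sum fun u _ => ?_
    rw [sq]
    exact mul_le_mul_of_nonneg_left
      (Finset.single_le_sum (fun u _ => hm u) (Finset.mem_univ u)) (hm u)
  have i1 : Integrable (fun y => ∏ v, g (t * ∑ u, m u * edgeMatrix (boltzmann y) u v))
      (edgeLaw n) := integrable_comp_boltzmann
    (F := fun w => ∏ v, g (t * ∑ u, m u * edgeMatrix w u v)) (by fun_prop)
  have i2 : Integrable (fun y => ∏ v, ∏ u, g (t * (m u * edgeMatrix (boltzmann y) u v)))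
      (edgeLaw n) := integrable_comp_boltzmann
    (F := fun w => ∏ v, ∏ u, g (t * (m u * edgeMatrix w u v))) (by fun_prop)
  have i3 : Integrable (fun y => ∑ v, ((∑ u, m u * edgeMatrix (boltzmann y) u v) ^ 2
      - ∑ u, (m u * edgeMatrix (boltzmann y) u v) ^ 2)) (edgeLaw n) := integrable_comp_boltzmann
    (F := fun w => ∑ v, ((∑ u, m u * edgeMatrix w u v) ^ 2
      - ∑ u, (m u * edgeMatrix w u v) ^ 2)) (by fun_prop)
  have h1 : ‖∫ y, ∏ v, g (t * ∑ u, m u * edgeMatrix (boltzmann y) u v) ∂(edgeLaw n)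
      - ∫ y, ∏ v, ∏ u, g (t * (m u * edgeMatrix (boltzmann y) u v)) ∂(edgeLaw n)‖
      ≤ t ^ 2 * (∑ u, m u) ^ 2 / n := by
    rw [← integral_sub i1 i2]
    calc _ ≤ ∫ y, t ^ 2 * ∑ v, ((∑ u, m u * edgeMatrix (boltzmann y) u v) ^ 2
          - ∑ u, (m u * edgeMatrix (boltzmann y) u v) ^ 2) ∂(edgeLaw n) := by
          refine norm_integral_le_of_norm_le (i3.const_mul _) (Eventually.of_forall fun y => ?_)
          refine (norm_prod_sub_prod_le _ (fun _ _ => hg.norm_le_one _) fun v _ => ?_).trans ?_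
          · rw [norm_prod]
            exact Finset.prod_le_one (fun _ _ => norm_nonneg _) fun _ _ => hg.norm_le_one _
          · rw [Finset.mul_sum]
            exact Finset.sum_le_sum fun v _ => hg.norm_sum_sub_prod_le _ _
              (fun u _ => mul_nonneg (hm u) (edgeMatrix_nonneg (boltzmann_nonneg y) u v)) t
      _ ≤ t ^ 2 * ((∑ u, m u) ^ 2 / (1 + n)) := by
          rw [integral_const_mul]
          exact mul_le_mul_of_nonneg_left (integral_sum_collision_le hm) (sq_nonneg t)
      _ ≤ t ^ 2 * (∑ u, m u) ^ 2 / n := by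
          rw [mul_div_assoc]
          gcongr
          linarith
  have h2 : ‖∏ u, edgeTransform n g (t * m u) ^ (n - height u)
      - ∏ u, Complex.exp (-poissonExponent g (t * m u))‖
      ≤ ((k + 1) * |t| * ∑ u, m u + 3 * t ^ 2 * (∑ u, m u) ^ 2) / n := by
    refine (norm_prod_sub_prod_le _ (fun u _ => ?_) fun u _ =>
      hg.exp_neg_poissonExponent.norm_le_one _).trans ?_
    · rw [norm_pow]
      exact pow_le_one₀ (norm_nonneg _) (hg.norm_edgeTransform_le_one n _)
    · calc _ ≤ ∑ u, ((k + 1) * |t| * m u + 3 * t ^ 2 * m u ^ 2) / n := by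
            refine Finset.sum_le_sum fun u _ => ?_
            by_cases hu : m u = 0
            · rw [hu, mul_zero, hg.edgeTransform_zero, hg.exp_neg_poissonExponent.map_zero]
              simp
            · have hku := hmk u hu
              have hkn : k ≤ n := by
                rw [← hku]
                simpa using hammingDist_le_card_fintype (x := u) (y := origin n)
              rw [hku]
              refine (hg.norm_edgeTransform_pow_sub_le hn hkn _).trans_eq ?_
              rw [abs_mul, abs_of_nonneg (hm u)]
              ring
        _ = ((k + 1) * |t| * ∑ u, m u + 3 * t ^ 2 * ∑ u, m u ^ 2) / n := by
            rw [← Finset.sum_div, Finset.sum_add_distrib, Finset.mul_sum, Finset.mul_sum]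
        _ ≤ _ := by gcongr
  rw [integral_prod_edge_eq hg] at h1
  refine (norm_sub_le_norm_sub_add_norm_sub _ _ _).trans ((add_le_add h1 h2).trans_eq ?_)
  ring

lemma norm_integral_forwardMass_succ_sub_le {g : ℝ → ℂ} (hg : IsNearlyMultiplicative g)
    (hn : 0 < n) (t : ℝ) (k : ℕ) :
    ‖∫ x, ∏ v, g (t * forwardMass (boltzmann x) (k + 1) v) ∂(edgeLaw n)
      - ∫ x, ∏ u, Complex.exp (-poissonExponent g (t * forwardMass (boltzmann x) k u))
        ∂(edgeLaw n)‖ ≤ ((k + 1) * |t| + 4 * t ^ 2 * 2 ^ k) / n := by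
  have hc := hg.continuous
  have hc' := hg.exp_neg_poissonExponent.continuous
  have h := integral_forwardMass_eq (n := n) k
      (Φ := fun m w => ∏ v, g (t * ∑ u, m u * edgeMatrix w u v)) (by fun_prop)
      (fun m hm w w' hw => Finset.prod_congr rfl fun v _ => congrArg (fun s => g (t * s)) <|
        Finset.sum_congr rfl fun u _ => mul_edgeMatrix_congr hm hw u v)
  simp only [forwardMass_succ]
  have i2 : Integrable (fun x => ∏ u, Complex.exp (-poissonExponent g
      (t * forwardMass (boltzmann x) k u))) (edgeLaw n) := integrable_comp_boltzmann
    (F := fun w => ∏ u, Complex.exp (-poissonExponent g (t * forwardMass w k u)))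
    (continuous_finsetProd _ fun u _ => hc'.comp (by fun_prop))
  have i1 : Integrable (fun x => ∫ y, ∏ v, g (t * ∑ u, forwardMass (boltzmann x) k u *
      edgeMatrix (boltzmann y) u v) ∂(edgeLaw n)) (edgeLaw n) := by
    refine .of_bound ?_ 1 (Eventually.of_forall fun x => ?_)
    · refine (StronglyMeasurable.integral_prod_right' (f := fun q : (Edge n → ℝ) × (Edge n → ℝ) =>
        ∏ v, g (t * ∑ u, forwardMass (boltzmann q.1) k u * edgeMatrix (boltzmann q.2) u v))
        ?_).aestronglyMeasurable
      exact Continuous.stronglyMeasurable (by fun_prop)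
    · refine (norm_integral_le_of_norm_le_const (C := 1) (Eventually.of_forall fun y => ?_)).trans_eq
        (by simp)
      rw [norm_prod]
      exact Finset.prod_le_one (fun _ _ => norm_nonneg _) fun _ _ => hg.norm_le_one _
  rw [h, ← integral_sub i1 i2]
  have hW := integrable_totalMass (n := n) k
  have hW2 := integrable_totalMass_sq (n := n) k
  calc _ ≤ ∫ x, ((k + 1) * |t| * totalMass k x + 4 * t ^ 2 * totalMass k x ^ 2) / n
        ∂(edgeLaw n) := by
        refine norm_integral_le_of_norm_le
          (((hW.const_mul _).add (hW2.const_mul _)).div_const _) (Eventually.of_forall fun x => ?_)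
        exact norm_integral_prod_sub_le hg hn t
          (fun u => forwardMass_nonneg (boltzmann_nonneg x) k u) fun u hu => forwardMass_height hu
    _ ≤ _ := by
        rw [integral_div, integral_add (hW.const_mul _) (hW2.const_mul _), integral_const_mul,
          integral_const_mul]
        have h1 := integral_totalMass_le_one (n := n) k
        have h2 := integral_totalMass_sq_le (n := n) k
        refine div_le_div_of_nonneg_right (add_le_add ?_ ?_) (Nat.cast_nonneg n)
        · exact mul_le_of_le_one_right (by positivity) h1
        · exact mul_le_mul_of_nonneg_left h2 (by positivity)

/-- Each step lowers the height `k` by one and raises the index `j` by one. The constant must not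
depend on `j`, which holds because all `massCharFun j` satisfy the same three bounds. The case `j =
0` gives the characteristic function of the total mass. -/
lemma exists_norm_integral_massCharFun_sub_le (t : ℝ) (k : ℕ) : ∃ C : ℝ, ∀ (n : ℕ), 0 < n →
    ∀ j, ‖∫ x, ∏ v : Vertex n, massCharFun j (t * forwardMass (boltzmann x) k v) ∂(edgeLaw n)
      - massCharFun (j + k) t‖ ≤ C / n := by
  induction k with
  | zero =>
    refine ⟨0, fun n hn j => ?_⟩
    have h0 := (isNearlyMultiplicative_massCharFun j).map_zero
    have h1 : ∀ x : Edge n → ℝ, ∏ v : Vertex n, massCharFun j (t * forwardMass (boltzmann x) 0 v)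
        = massCharFun j t := by
      intro x
      rw [Finset.prod_eq_single (origin n)]
      · rw [forwardMass_zero, if_pos rfl, mul_one]
      · intro v _ hv
        rw [forwardMass_zero, if_neg hv.symm, mul_zero, h0]
      · simp
    simp [h1]
  | succ k ih =>
    obtain ⟨C, hC⟩ := ih
    refine ⟨((k + 1) * |t| + 4 * t ^ 2 * 2 ^ k) + C, fun n hn j => ?_⟩
    have h1 := norm_integral_forwardMass_succ_sub_le (isNearlyMultiplicative_massCharFun j) hn t k
    have h2 := hC n hn (j + 1)
    rw [show j + 1 + k = j + (k + 1) by ring] at h2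
    rw [add_div]
    exact (norm_sub_le_norm_sub_add_norm_sub _ _ _).trans (add_le_add h1 h2)

/-- Convergence of the characteristic functions of the total masses. -/
lemma tendsto_integral_exp_totalMass (r : ℕ) (t : ℝ) :
    Tendsto (fun n => ∫ x, Complex.exp ((t * totalMass r x : ℝ) * Complex.I) ∂(edgeLaw n)) atTop
      (𝓝 (massCharFun r t)) := by
  obtain ⟨C, hC⟩ := exists_norm_integral_massCharFun_sub_le t r
  rw [tendsto_iff_norm_sub_tendsto_zero]
  refine squeeze_zero' (Eventually.of_forall fun _ => norm_nonneg _) ?_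
    (tendsto_const_div_atTop_nhds_zero_nat C)
  filter_upwards [eventually_gt_atTop 0] with n hn
  have h := hC n hn 0
  rw [zero_add] at h
  have h1 : ∀ x : Edge n → ℝ, ∏ v : Vertex n, massCharFun 0 (t * forwardMass (boltzmann x) r v)
      = Complex.exp ((t * totalMass r x : ℝ) * Complex.I) := by
    intro x
    simp only [massCharFun, totalMass]
    rw [← Complex.exp_sum, ← Finset.sum_mul, Finset.mul_sum]
    push_cast
    rfl
  simpa only [h1] using h

end CharacteristicFunctionOfMass

/-! ### Weak limits of the mass laws, and independence of the two ends of the cube. -/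

section WeakLimits

open Set Topology

lemma tendsto_charFun_of_tendsto {ι : Type*} {l : Filter ι} {μ : ι → ProbabilityMeasure ℝ}
    {μ₀ : ProbabilityMeasure ℝ} (h : Tendsto μ l (𝓝 μ₀)) (t : ℝ) :
    Tendsto (fun n => charFun (μ n : Measure ℝ) t) l (𝓝 (charFun (μ₀ : Measure ℝ) t)) := by
  rw [ProbabilityMeasure.tendsto_iff_forall_integral_rclike_tendsto ℂ] at h
  simp_rw [charFun_eq_integral_innerProbChar]
  exact h (BoundedContinuousFunction.innerProbChar t)

/-- A pointwise limit of characteristic functions that is continuous at the origin is the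
characteristic function of the weak limit. -/
lemma exists_tendsto_of_tendsto_charFun {μ : ℕ → ProbabilityMeasure ℝ} {f : ℝ → ℂ}
    (hf : ContinuousAt f 0)
    (h : ∀ t, Tendsto (fun n => charFun (μ n : Measure ℝ) t) atTop (𝓝 (f t))) :
    ∃ μ₀ : ProbabilityMeasure ℝ, Tendsto μ atTop (𝓝 μ₀) ∧
      ∀ t, charFun (μ₀ : Measure ℝ) t = f t := by
  have htight := isTightMeasureSet_of_tendsto_charFun (μ := fun n => (μ n : Measure ℝ)) hf h
  have hcompact : IsCompact (closure (range μ)) := isCompact_closure_of_isTightMeasureSet (by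
    refine htight.subset ?_
    rintro _ ⟨ν, ⟨n, rfl⟩, rfl⟩
    exact ⟨n, rfl⟩)
  -- Tightness gives relative compactness, hence a limit along a free ultrafilter. Its
  -- characteristic function must be `f`, and then the whole sequence converges to it.
  obtain ⟨μ₀, -, hμ₀⟩ := hcompact.ultrafilter_le_nhds ((hyperfilter ℕ).map μ)
    (le_principal_iff.2 (univ_mem' (f := (hyperfilter ℕ : Filter ℕ)) fun n =>
      subset_closure ⟨n, rfl⟩))
  have hμ₀' : Tendsto μ (hyperfilter ℕ : Filter ℕ) (𝓝 μ₀) := hμ₀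
  have hchar : ∀ t, charFun (μ₀ : Measure ℝ) t = f t := fun t =>
    tendsto_nhds_unique (tendsto_charFun_of_tendsto hμ₀' t) ((h t).mono_left Nat.hyperfilter_le_atTop)
  refine ⟨μ₀, ProbabilityMeasure.tendsto_of_tendsto_charFun fun t => ?_, hchar⟩
  rw [hchar]
  exact h t

/-- The law of the total mass at height `r` of the hypercube of dimension `n`. -/
noncomputable def massLaw (r n : ℕ) : ProbabilityMeasure ℝ :=
  ⟨(edgeLaw n).map (totalMass r),
    Measure.isProbabilityMeasure_map (continuous_totalMass r).aemeasurable⟩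

lemma charFun_map_edgeLaw {n : ℕ} {F : (Edge n → ℝ) → ℝ} (hF : Measurable F) (t : ℝ) :
    charFun ((edgeLaw n).map F) t
      = ∫ x, Complex.exp ((t * F x : ℝ) * Complex.I) ∂(edgeLaw n) := by
  rw [charFun_apply_real, integral_map hF.aemeasurable (by fun_prop)]
  simp only [Complex.ofReal_mul]

lemma exists_massLaw_limit : ∃ μ : ℕ → ProbabilityMeasure ℝ,
    (∀ r, Tendsto (massLaw r) atTop (𝓝 (μ r))) ∧
      Tendsto μ atTop (𝓝 ⟨expMeasure 1, inferInstance⟩) := by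
  have h : ∀ r, ∃ μ₀ : ProbabilityMeasure ℝ, Tendsto (massLaw r) atTop (𝓝 μ₀) ∧
      ∀ t, charFun (μ₀ : Measure ℝ) t = massCharFun r t := by
    intro r
    refine exists_tendsto_of_tendsto_charFun
      (isNearlyMultiplicative_massCharFun r).continuous.continuousAt fun t => ?_
    refine (tendsto_integral_exp_totalMass r t).congr fun n => ?_
    exact (charFun_map_edgeLaw (continuous_totalMass r).measurable t).symm
  choose μ hμ hchar using h
  refine ⟨μ, hμ, ProbabilityMeasure.tendsto_of_tendsto_charFun fun t => ?_⟩
  simp only [hchar]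
  refine (tendsto_massCharFun t).trans_eq ?_
  rw [← charFun_expMeasure_one]
  rfl

/-- The law of `c` times the product of two independent variables with the same law. -/
noncomputable def scaledProductLaw (c : ℝ) (μ : ProbabilityMeasure ℝ) : ProbabilityMeasure ℝ :=
  (μ.prod μ).map (f := fun q : ℝ × ℝ => q.1 * q.2 * c) (by fun_prop)

lemma continuous_scaledProductLaw (c : ℝ) : Continuous (scaledProductLaw c) := by
  have h : Continuous fun μ : ProbabilityMeasure ℝ => μ.prod μ :=
    ProbabilityMeasure.continuous_prod.comp (continuous_id.prodMk continuous_id)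
  exact (ProbabilityMeasure.continuous_map (f := fun q : ℝ × ℝ => q.1 * q.2 * c)
    (by fun_prop)).comp h

variable {n : ℕ}

/-- The total mass of the paths of length `k` that end in the target. -/
noncomputable def totalBackwardMass (k : ℕ) (x : Edge n → ℝ) : ℝ :=
  ∑ v, backwardMass (boltzmann x) k v

lemma continuous_totalBackwardMass (k : ℕ) : Continuous (totalBackwardMass (n := n) k) := by
  unfold totalBackwardMass
  fun_prop

lemma measurePreserving_reverseEdge :
    MeasurePreserving (fun (x : Edge n → ℝ) e => x (reverseEdge e)) (edgeLaw n) (edgeLaw n) := by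
  have h := measurePreserving_piCongrLeft (α := fun _ : Edge n => ℝ)
    (fun _ : Edge n => expMeasure 1) (reverseEdge (n := n)).symm
  convert h using 1
  ext x e
  exact (Equiv.piCongrLeft_apply_apply (fun _ : Edge n => ℝ) reverseEdge.symm x
    (reverseEdge e)).symm.trans (by simp; rfl)

lemma totalBackwardMass_eq (k : ℕ) (x : Edge n → ℝ) :
    totalBackwardMass k x = totalMass k fun e => x (reverseEdge e) :=
  sum_backwardMass_eq _ _

lemma map_totalBackwardMass (k : ℕ) :
    (edgeLaw n).map (totalBackwardMass k) = (edgeLaw n).map (totalMass k) := by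
  have h := measurePreserving_reverseEdge (n := n)
  nth_rw 2 [← h.map_eq]
  rw [Measure.map_map (continuous_totalMass k).measurable h.measurable]
  congr 1
  ext x
  exact totalBackwardMass_eq k x

lemma integral_totalBackwardMass (k : ℕ) :
    ∫ x, totalBackwardMass k x ∂(edgeLaw n) = ∫ x, totalMass k x ∂(edgeLaw n) := by
  have h1 := integral_map (μ := edgeLaw n) (continuous_totalBackwardMass k).aemeasurable
    (f := id) (by fun_prop)
  have h2 := integral_map (μ := edgeLaw n) (continuous_totalMass k).aemeasurable
    (f := id) (by fun_prop)
  rw [map_totalBackwardMass] at h1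
  exact h1.symm.trans h2

open Classical in
lemma totalMass_piecewise (r : ℕ) (x y : Edge n → ℝ) :
    totalMass r ({e : Edge n | e.level < r}.piecewise x y) = totalMass r x := by
  refine Finset.sum_congr rfl fun v _ => forwardMass_congr (fun e he => ?_) v
  simp only [boltzmann]
  rw [piecewise_eq_of_mem _ _ _ (show e ∈ {e : Edge n | e.level < r} from he)]

open Classical in
lemma totalBackwardMass_piecewise {r : ℕ} (hr : 2 * r ≤ n) (x y : Edge n → ℝ) :
    totalBackwardMass r ({e : Edge n | e.level < r}.piecewise x y) = totalBackwardMass r y := by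
  refine Finset.sum_congr rfl fun v _ => backwardMass_congr (fun e he => ?_) v
  simp only [boltzmann]
  rw [piecewise_eq_of_notMem _ _ _ (show e ∉ {e : Edge n | e.level < r} by
    simp only [mem_ofPred_eq]; omega)]

/-- The forward mass uses levels below `r`, the backward mass levels from `n - r ≥ r` on. Gluing two
independent samples at level `r` keeps the joint law and exhibits the two masses as independent;
reversal gives them equal laws. -/
lemma map_totalMass_mul_totalBackwardMass {r : ℕ} (hr : 2 * r ≤ n) (c : ℝ) :
    (edgeLaw n).map (fun x => totalMass r x * totalBackwardMass r x * c)
      = scaledProductLaw c (massLaw r n) := by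
  classical
  have h := measurePreserving_piecewise (expMeasure 1) {e : Edge n | e.level < r}
  have m1 := (continuous_totalMass (n := n) r).measurable
  have m2 := (continuous_totalBackwardMass (n := n) r).measurable
  have e1 : (scaledProductLaw c (massLaw r n) : Measure ℝ)
      = (((edgeLaw n).map (totalMass r)).prod ((edgeLaw n).map (totalMass r))).map
        fun q : ℝ × ℝ => q.1 * q.2 * c := rfl
  have e2 : ((edgeLaw n).map (totalMass r)).prod ((edgeLaw n).map (totalMass r))
      = ((edgeLaw n).map (totalMass r)).prod ((edgeLaw n).map (totalBackwardMass r)) := by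
    rw [map_totalBackwardMass]
  rw [e1, e2, Measure.map_prod_map _ _ m1 m2, Measure.map_map (by fun_prop) (m1.prodMap m2)]
  have m3 : Measurable fun x : Edge n → ℝ => totalMass r x * totalBackwardMass r x * c :=
    (m1.mul m2).mul_const c
  conv_lhs => rw [edgeLaw, ← h.map_eq]
  rw [Measure.map_map m3 h.measurable]
  congr 1
  ext q
  simp only [Function.comp_apply]
  rw [totalMass_piecewise, totalBackwardMass_piecewise hr]
  rfl

lemma integrable_totalMass_mul_totalBackwardMass (r : ℕ) :
    Integrable (fun x => totalMass r x * totalBackwardMass r x) (edgeLaw n) :=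
  integrable_comp_boltzmann
    (F := fun w => (∑ u, forwardMass w r u) * ∑ v, backwardMass w r v) (by fun_prop)

lemma integral_totalMass_mul_totalBackwardMass_le_one {r : ℕ} (hr : 2 * r ≤ n) :
    ∫ x, totalMass r x * totalBackwardMass r x ∂(edgeLaw n) ≤ 1 := by
  classical
  rw [integral_pi_eq_integral_piecewise (expMeasure 1) {e : Edge n | e.level < r}
    (integrable_totalMass_mul_totalBackwardMass r)]
  simp only [totalMass_piecewise, totalBackwardMass_piecewise hr, integral_const_mul,
    integral_mul_const, integral_totalBackwardMass]
  have h0 : 0 ≤ ∫ x, totalMass r x ∂(edgeLaw n) := integral_nonneg fun x => totalMass_nonneg r x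
  exact mul_le_one₀ (integral_totalMass_le_one r) h0 (integral_totalMass_le_one r)

end WeakLimits

/-! ### Local asymptotics of the Gamma law of the inner part of a path. -/

section GammaAsymptotics

open Set Topology

/-- The rescaled density of a Gamma law of shape `n - 2 r` near one. -/
noncomputable def rescaledGammaDensity (r n : ℕ) (z : ℝ) : ℝ :=
  (n - 2 * r).factorial / n * gammaPDFReal (n - 2 * r : ℕ) 1 (1 + z / n)

lemma measurable_rescaledGammaDensity (r n : ℕ) : Measurable (rescaledGammaDensity r n) := by
  unfold rescaledGammaDensity
  fun_prop

lemma rescaledGammaDensity_eq {r n : ℕ} (hn : 2 * r < n) {z : ℝ} (hz : 0 ≤ 1 + z / n) :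
    rescaledGammaDensity r n z
      = (n - 2 * r : ℕ) / n * (1 + z / n) ^ (n - 2 * r - 1) * Real.exp (-(1 + z / n)) := by
  obtain ⟨j, hj⟩ : ∃ j, n - 2 * r = j + 1 := ⟨n - 2 * r - 1, by omega⟩
  rw [rescaledGammaDensity, gammaPDFReal, if_pos hz, hj]
  push_cast
  rw [Real.Gamma_nat_eq_factorial, add_sub_cancel_right, Real.rpow_natCast, Real.one_rpow,
    Nat.factorial_succ]
  have : (j.factorial : ℝ) ≠ 0 := by positivity
  push_cast
  simp only [one_mul]
  field_simp

lemma rescaledGammaDensity_nonneg {r n : ℕ} (hn : 2 * r < n) (z : ℝ) :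
    0 ≤ rescaledGammaDensity r n z := by
  have : (0 : ℝ) < (n - 2 * r : ℕ) := by exact_mod_cast Nat.sub_pos_of_lt hn
  exact mul_nonneg (by positivity) (gammaPDFReal_nonneg this one_pos _)

/-- From `1 + u ≤ e^u` the density is at most `e^{θz - 1}` with `θ = (n - 2r - 2)/n`. The assumption
on `n` says exactly that `θ ≥ 1/2`, so the bound decays like `e^{z/2}` at minus infinity, uniformly
in `n`. -/
lemma rescaledGammaDensity_le {r n : ℕ} (hn : 4 * r + 4 ≤ n) (z : ℝ) :
    rescaledGammaDensity r n z ≤ Real.exp (z / 2) + Real.exp z := by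
  have hn0 : (0 : ℝ) < n := by exact_mod_cast (by omega : 0 < n)
  rcases lt_or_ge (1 + z / n) 0 with hz | hz
  · rw [rescaledGammaDensity, gammaPDFReal, if_neg (not_le.2 hz), mul_zero]
    positivity
  · rw [rescaledGammaDensity_eq (by omega) hz]
    have hm : ((n - 2 * r : ℕ) : ℝ) = n - 2 * r := by
      rw [Nat.cast_sub (by omega)]; push_cast; ring
    have hm1 : ((n - 2 * r - 1 : ℕ) : ℝ) = n - 2 * r - 1 := by
      rw [Nat.cast_sub (by omega), hm]; push_cast; ring
    have hr0 : (0 : ℝ) ≤ r := Nat.cast_nonneg r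
    have hnr : (4 * r + 4 : ℝ) ≤ n := by exact_mod_cast hn
    have h1 : ((n - 2 * r : ℕ) : ℝ) / n ≤ 1 := by
      rw [div_le_one hn0, hm]; linarith
    have h2 : (1 + z / n) ^ (n - 2 * r - 1) ≤ Real.exp ((n - 2 * r - 1 : ℕ) * (z / n)) := by
      rw [Real.exp_nat_mul]
      exact pow_le_pow_left₀ hz (by linarith [Real.add_one_le_exp (z / n)]) _
    set θ : ℝ := (n - 2 * r - 2) / n with hθ
    have hθ1 : θ ≤ 1 := by rw [hθ, div_le_one hn0]; linarith
    have hθ2 : 1 / 2 ≤ θ := by rw [hθ, div_le_div_iff₀ two_pos hn0]; linarith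
    calc _ ≤ 1 * Real.exp ((n - 2 * r - 1 : ℕ) * (z / n)) * Real.exp (-(1 + z / n)) := by
          gcongr
      _ = Real.exp (θ * z - 1) := by
          rw [one_mul, ← Real.exp_add, hm1]
          congr 1
          rw [hθ]
          field_simp
          ring
      _ ≤ Real.exp (max (z / 2) z) := by
          rw [Real.exp_le_exp]
          rcases le_total z 0 with h | h
          · have := le_max_left (z / 2) z
            nlinarith
          · have := le_max_right (z / 2) z
            nlinarith
      _ ≤ Real.exp (z / 2) + Real.exp z := by
          have := Real.exp_pos (z / 2)
          have := Real.exp_pos z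
          rcases max_choice (z / 2) z with h | h <;> rw [h] <;> linarith

lemma tendsto_one_add_div_natCast (z : ℝ) :
    Tendsto (fun n : ℕ => 1 + z / (n : ℝ)) atTop (𝓝 1) := by
  simpa using (tendsto_const_div_atTop_nhds_zero_nat z).const_add 1

lemma tendsto_rescaledGammaDensity (r : ℕ) (z : ℝ) :
    Tendsto (fun n => rescaledGammaDensity r n z) atTop (𝓝 (Real.exp (z - 1))) := by
  have h1 := tendsto_one_add_div_natCast z
  have h2 := tendsto_one_add_div_natCast (-(2 * r : ℝ))
  have h3 := Real.tendsto_one_add_div_pow_exp z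
  have h4 : Tendsto (fun n : ℕ => Real.exp (-(1 + z / (n : ℝ)))) atTop (𝓝 (Real.exp (-1))) :=
    (Real.continuous_exp.tendsto _).comp h1.neg
  have h5 := ((h2.mul (h3.div (h1.pow (2 * r + 1)) (by simp))).mul h4)
  rw [one_pow, div_one, one_mul, ← Real.exp_add] at h5
  refine h5.congr' ?_
  filter_upwards [h1.eventually (eventually_gt_nhds one_pos), eventually_gt_atTop (2 * r)]
    with n hz hn
  have hn0 : (n : ℝ) ≠ 0 := by exact_mod_cast (by omega : n ≠ 0)
  rw [rescaledGammaDensity_eq hn hz.le, Nat.cast_sub hn.le]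
  congr 2
  · push_cast
    field_simp
    ring
  · simp only [Pi.div_apply]
    rw [div_eq_iff (pow_pos hz _).ne', ← pow_add]
    congr 1
    omega

/-- The probability that a Gamma variable of shape `n - 2 r` brings a path into the window. -/
noncomputable def gammaHit (r n : ℕ) (A : Set ℝ) (s : ℝ) : ℝ :=
  ∫ g, A.indicator (fun _ => (1 : ℝ)) (n * (s + g - 1)) ∂(gammaMeasure (n - 2 * r : ℕ) 1)

/-- Substitute `x = n (s + g - 1)`; the outer sum then appears as the shift `n s`. -/
lemma factorial_mul_gammaHit {r n : ℕ} (hn : 2 * r < n) {A : Set ℝ} (hA : MeasurableSet A)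
    (s : ℝ) :
    (n - 2 * r).factorial * gammaHit r n A s
      = ∫ x in A, rescaledGammaDensity r n (x - n * s) := by
  have hn0 : (0 : ℝ) < n := by exact_mod_cast (by omega : 0 < n)
  have hm0 : (0 : ℝ) < (n - 2 * r : ℕ) := by exact_mod_cast Nat.sub_pos_of_lt hn
  let F : ℝ → ℝ := fun g =>
    gammaPDFReal (n - 2 * r : ℕ) 1 g * A.indicator (fun _ => (1 : ℝ)) (n * (s + g - 1))
  have h1 : gammaHit r n A s = ∫ g, F g := by
    rw [gammaHit, gammaMeasure, integral_withDensity_eq_integral_toReal_smul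
      (by unfold gammaPDF; fun_prop) (Eventually.of_forall fun x => by simp [gammaPDF])]
    refine integral_congr_ae (Eventually.of_forall fun g => ?_)
    simp only [gammaPDF, F, smul_eq_mul]
    rw [ENNReal.toReal_ofReal (gammaPDFReal_nonneg hm0 one_pos g)]
  have h2 : ∫ x, F ((1 - s) + x / n) = n * ∫ g, F g := by
    have h3 := Measure.integral_comp_div (fun y => F ((1 - s) + y)) (n : ℝ)
    rw [h3, abs_of_pos hn0, integral_add_left_eq_self F, smul_eq_mul]
  have h4 : gammaHit r n A s = (∫ x, F ((1 - s) + x / n)) / n := by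
    rw [h2, h1]
    field_simp
  rw [h4, ← mul_div_assoc, mul_comm, mul_div_assoc, mul_comm, ← integral_const_mul,
    ← integral_indicator hA]
  refine integral_congr_ae (Eventually.of_forall fun x => ?_)
  have e1 : (n : ℝ) * (s + (1 - s + x / n) - 1) = x := by field_simp; ring
  have e2 : 1 - s + x / n = 1 + (x - n * s) / n := by field_simp; ring
  simp only [F]
  rw [e1, e2]
  by_cases hx : x ∈ A
  · rw [indicator_of_mem hx, indicator_of_mem hx, mul_one, rescaledGammaDensity]
  · rw [indicator_of_notMem hx, indicator_of_notMem hx, mul_zero, mul_zero]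

lemma integrableOn_exp_sub_one {A : Set ℝ} {B : ℝ} (hB : A ⊆ Iic B) :
    IntegrableOn (fun x => Real.exp (x - 1)) A := by
  have h := ((integrableOn_exp_mul_Iic one_pos B).mono_set hB).const_mul (Real.exp (-1))
  refine h.congr (Eventually.of_forall fun x => ?_)
  simp only [← Real.exp_add]
  congr 1
  ring

/-- The error density, with an exponential weight. -/
noncomputable def weightedDensityError (r n : ℕ) (z : ℝ) : ℝ :=
  Real.exp (-(z / 4)) * |rescaledGammaDensity r n z - Real.exp (z - 1)|

lemma measurable_weightedDensityError (r n : ℕ) : Measurable (weightedDensityError r n) := by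
  have := measurable_rescaledGammaDensity r n
  unfold weightedDensityError
  fun_prop

lemma weightedDensityError_nonneg (r n : ℕ) (z : ℝ) : 0 ≤ weightedDensityError r n z := by
  unfold weightedDensityError
  positivity

/-- The weight `e^{-z/4}` uses up only half of the decay `e^{z/2}` at minus infinity, so an
integrable majorant on `(-∞, B]` remains. -/
lemma weightedDensityError_le {r n : ℕ} (hn : 4 * r + 4 ≤ n) (z : ℝ) :
    weightedDensityError r n z ≤ Real.exp (1 / 4 * z) + 2 * Real.exp (3 / 4 * z) := by
  have h1 := rescaledGammaDensity_le hn z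
  have h2 := rescaledGammaDensity_nonneg (by omega : 2 * r < n) z
  have h3 : Real.exp (z - 1) ≤ Real.exp z := Real.exp_le_exp.2 (by linarith)
  have h4 := Real.exp_pos (z - 1)
  have h5 := Real.exp_pos (z / 2)
  have h6 := Real.exp_pos z
  have h7 : |rescaledGammaDensity r n z - Real.exp (z - 1)|
      ≤ Real.exp (z / 2) + 2 * Real.exp z := by
    rw [abs_le]; constructor <;> linarith
  refine (mul_le_mul_of_nonneg_left h7 (Real.exp_pos _).le).trans_eq ?_
  rw [mul_add, mul_left_comm, ← Real.exp_add, ← Real.exp_add]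
  congr 2
  · ring
  · congr 1; ring

lemma integrableOn_weightedDensityError_bound (B : ℝ) :
    IntegrableOn (fun z => Real.exp (1 / 4 * z) + 2 * Real.exp (3 / 4 * z)) (Iic B) :=
  (integrableOn_exp_mul_Iic (by norm_num) B).add
    ((integrableOn_exp_mul_Iic (by norm_num) B).const_mul 2)

lemma integrableOn_weightedDensityError {r n : ℕ} (hn : 4 * r + 4 ≤ n) (B : ℝ) :
    IntegrableOn (weightedDensityError r n) (Iic B) := by
  refine (integrableOn_weightedDensityError_bound B).mono'
    (measurable_weightedDensityError r n).aestronglyMeasurable (Eventually.of_forall fun z => ?_)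
  rw [Real.norm_eq_abs, abs_of_nonneg (weightedDensityError_nonneg r n z)]
  exact weightedDensityError_le hn z

lemma tendsto_integral_weightedDensityError (r : ℕ) (B : ℝ) :
    Tendsto (fun n => ∫ z in Iic B, weightedDensityError r n z) atTop (𝓝 0) := by
  rw [← integral_zero ℝ ℝ (μ := volume.restrict (Iic B))]
  refine tendsto_integral_filter_of_dominated_convergence _
    (Eventually.of_forall fun n => (measurable_weightedDensityError r n).aestronglyMeasurable) ?_
    (integrableOn_weightedDensityError_bound B) (Eventually.of_forall fun z => ?_)
  · filter_upwards [eventually_ge_atTop (4 * r + 4)] with n hn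
    refine Eventually.of_forall fun z => ?_
    rw [Real.norm_eq_abs, abs_of_nonneg (weightedDensityError_nonneg r n z)]
    exact weightedDensityError_le hn z
  · have h := (((tendsto_rescaledGammaDensity r z).sub_const (Real.exp (z - 1))).abs).const_mul
      (Real.exp (-(z / 4)))
    rwa [sub_self, abs_zero, mul_zero] at h

/-- An error that is merely uniform in `s` would be useless after summing over the `n!` paths. Here
the exponential weight of the density error is traded for the factor `e^{-ns/4}`, whose mean over
the `2r` outer edges compensates their number. -/
lemma abs_factorial_mul_gammaHit_sub_le {r n : ℕ} (hn : 4 * r + 4 ≤ n) {A : Set ℝ}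
    (hA : MeasurableSet A) {B : ℝ} (hB : A ⊆ Iic B) {s : ℝ} (hs : 0 ≤ s) :
    |(n - 2 * r).factorial * gammaHit r n A s
      - (∫ x in A, Real.exp (x - 1)) * Real.exp (-(n * s))|
      ≤ Real.exp (B / 4) * (∫ z in Iic B, weightedDensityError r n z)
        * Real.exp (-(n / 4 * s)) := by
  have hns : 0 ≤ n * s := by positivity
  let φ : ℝ → ℝ := (Iic B).indicator (weightedDensityError r n)
  have hφi : Integrable φ :=
    (integrable_indicator_iff measurableSet_Iic).2 (integrableOn_weightedDensityError hn B)
  have hφ0 : ∀ z, 0 ≤ φ z := fun z =>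
    indicator_nonneg (fun z _ => weightedDensityError_nonneg r n z) z
  have hshift : Integrable fun x => φ (x - n * s) := hφi.comp_sub_right _
  have key : ∀ x ∈ A, |rescaledGammaDensity r n (x - n * s) - Real.exp (x - n * s - 1)|
      ≤ Real.exp (B / 4) * Real.exp (-(n / 4 * s)) * φ (x - n * s) := by
    intro x hx
    have hxB : x ≤ B := hB hx
    have h1 : φ (x - n * s) = weightedDensityError r n (x - n * s) :=
      indicator_of_mem (show x - n * s ∈ Iic B from mem_Iic.2 (by linarith)) _
    rw [h1, weightedDensityError, ← mul_assoc, ← Real.exp_add, ← Real.exp_add]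
    -- The three exponents add up to `(B - x)/4 ≥ 0`.
    refine le_mul_of_one_le_left (abs_nonneg _) (Real.one_le_exp ?_)
    linarith
  have hmeas := measurable_rescaledGammaDensity r n
  have hdi : IntegrableOn (fun x => rescaledGammaDensity r n (x - n * s)
      - Real.exp (x - n * s - 1)) A := by
    refine Integrable.mono' ((hshift.const_mul
      (Real.exp (B / 4) * Real.exp (-(n / 4 * s)))).integrableOn (s := A))
      (by fun_prop) ((ae_restrict_iff' hA).2 (Eventually.of_forall key))
  have hei : IntegrableOn (fun x => Real.exp (x - n * s - 1)) A := by
    refine ((integrableOn_exp_sub_one hB).mul_const (Real.exp (-(n * s)))).congr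
      (Eventually.of_forall fun x => ?_)
    simp only [← Real.exp_add]
    congr 1
    ring
  have e1 : (∫ x in A, Real.exp (x - 1)) * Real.exp (-(n * s))
      = ∫ x in A, Real.exp (x - n * s - 1) := by
    rw [← integral_mul_const]
    refine integral_congr_ae (Eventually.of_forall fun x => ?_)
    simp only [← Real.exp_add]
    congr 1
    ring
  have e2 : (n - 2 * r).factorial * gammaHit r n A s
      - (∫ x in A, Real.exp (x - 1)) * Real.exp (-(n * s))
      = ∫ x in A, (rescaledGammaDensity r n (x - n * s) - Real.exp (x - n * s - 1)) := by
    have h := integral_add hdi hei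
    simp only [sub_add_cancel] at h
    rw [factorial_mul_gammaHit (by omega) hA, e1, h, add_sub_cancel_right]
  rw [e2, ← Real.norm_eq_abs]
  calc _ ≤ ∫ x in A, Real.exp (B / 4) * Real.exp (-(n / 4 * s)) * φ (x - n * s) :=
        norm_integral_le_of_norm_le ((hshift.const_mul _).integrableOn)
          ((ae_restrict_iff' hA).2 (Eventually.of_forall key))
    -- Over the whole line, translation invariance removes the shift `n s`.
    _ ≤ ∫ x, Real.exp (B / 4) * Real.exp (-(n / 4 * s)) * φ (x - n * s) :=
        setIntegral_le_integral (hshift.const_mul _) (Eventually.of_forall fun x =>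
          mul_nonneg (by positivity) (hφ0 _))
    _ = _ := by
        rw [integral_const_mul, integral_sub_right_eq_self φ, integral_indicator measurableSet_Iic]
        ring

end GammaAsymptotics

/-! ### Comparison of the conditional expectation with the product of the two total masses. -/

section Comparison

open Set Topology

variable {n : ℕ}

/-- The indicator that the rescaled weight of a path lies in the window. -/
noncomputable def windowIndicator (A : Set ℝ) (p : OrientedPath n) (x : Edge n → ℝ) : ℝ :=
  A.indicator (fun _ => (1 : ℝ)) (n * (∑ i : Fin n, x (OrientedPath.edge p i) - 1))

lemma measurable_windowIndicator {A : Set ℝ} (hA : MeasurableSet A) (p : OrientedPath n) :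
    Measurable (windowIndicator A p) :=
  (measurable_const.indicator hA).comp (by fun_prop)

lemma norm_windowIndicator_le (A : Set ℝ) (p : OrientedPath n) (x : Edge n → ℝ) :
    ‖windowIndicator A p x‖ ≤ 1 :=
  (norm_indicator_le_norm_self _ _).trans (by simp)

open Classical in
/-- The conditional expected number of paths in the window, as a function of the weights. -/
noncomputable def conditionalCount (r : ℕ) (A : Set ℝ) (x : Edge n → ℝ) : ℝ :=
  ∑ p : OrientedPath n,
    ∫ y, windowIndicator A p ({e : Edge n | e.IsOuter r}.piecewise x y) ∂(edgeLaw n)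

open Classical in
lemma measurable_conditionalCount (r : ℕ) {A : Set ℝ} (hA : MeasurableSet A) :
    Measurable (conditionalCount (n := n) r A) := by
  refine Finset.measurable_fun_sum _ fun p _ => ?_
  refine (StronglyMeasurable.integral_prod_right' (f := fun q : (Edge n → ℝ) × (Edge n → ℝ) =>
    windowIndicator A p ({e : Edge n | e.IsOuter r}.piecewise q.1 q.2)) ?_).measurable
  exact ((measurable_windowIndicator hA p).comp (measurable_piecewise_prod _)).stronglyMeasurable

lemma poissonParameter_ae_eq {Ω : Type*} [MeasurableSpace Ω] (P : Measure Ω)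
    [IsProbabilityMeasure P] {ξ : Edge n → Ω → ℝ} (hξ : ∀ e, Measurable (ξ e))
    (hlaw : P.map (fun ω e => ξ e ω) = edgeLaw n) (r : ℕ) {A : Set ℝ} (hA : MeasurableSet A) :
    poissonParameter P ξ r A =ᵐ[P] fun ω => conditionalCount r A fun e => ξ e ω := by
  classical
  have h : ∀ p : OrientedPath n, P[pathIndicator ξ A p | outerSigma ξ r]
      =ᵐ[P] fun ω => ∫ y, windowIndicator A p
        ({e : Edge n | e.IsOuter r}.piecewise (fun e => ξ e ω) y) ∂(edgeLaw n) := fun p =>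
    condExp_comap_restrict_ae_eq P (expMeasure 1) (measurable_pi_lambda _ hξ) hlaw
      {e : Edge n | e.IsOuter r} (measurable_windowIndicator hA p)
      (norm_windowIndicator_le A p)
  have h' := ae_all_iff.2 h
  filter_upwards [h'] with ω hω
  exact Finset.sum_congr rfl fun p _ => hω p

-- The inner edges of a path are `n - 2r` distinct resampled coordinates, so their sum has a Gamma
-- law; the strict inequality excludes the empty sum.
open Classical in
lemma integral_windowIndicator_piecewise {r : ℕ} (hn : 2 * r < n) {A : Set ℝ}
    (hA : MeasurableSet A) (p : OrientedPath n) (x : Edge n → ℝ) :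
    ∫ y, windowIndicator A p ({e : Edge n | e.IsOuter r}.piecewise x y) ∂(edgeLaw n)
      = gammaHit r n A (∑ i ∈ outerSteps n r, x (OrientedPath.edge p i)) := by
  let T : Finset (Edge n) := (outerSteps n r)ᶜ.image (OrientedPath.edge p)
  have hT : T.card = n - 2 * r := by
    rw [Finset.card_image_of_injective _ (orientedPath_edge_injective p),
      card_compl_outerSteps hn.le]
  have hTn : T.Nonempty := Finset.card_pos.1 (by omega)
  have hm : Measurable fun g : ℝ => A.indicator (fun _ => (1 : ℝ))
      (n * (∑ i ∈ outerSteps n r, x (OrientedPath.edge p i) + g - 1)) :=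
    (measurable_const.indicator hA).comp (by fun_prop)
  rw [gammaHit, ← hT, ← map_sum_pi_expMeasure hTn,
    integral_map (by fun_prop) hm.aestronglyMeasurable]
  refine integral_congr_ae (Eventually.of_forall fun y => ?_)
  simp only [windowIndicator]
  congr 3
  rw [← Finset.sum_add_sum_compl (outerSteps n r)]
  congr 1
  · refine Finset.sum_congr rfl fun i hi => ?_
    exact piecewise_eq_of_mem _ _ _ ((isOuter_orientedPath_edge p i).2 (by simpa using hi))
  · rw [Finset.sum_image fun i _ j _ h => orientedPath_edge_injective p h]
    refine Finset.sum_congr rfl fun i hi => ?_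
    refine piecewise_eq_of_notMem _ _ _ fun h => ?_
    rw [Finset.mem_compl] at hi
    exact hi (by simpa using (isOuter_orientedPath_edge p i).1 h)

lemma integral_prod_outerSteps {r : ℕ} (hr : 2 * r ≤ n) {θ : ℝ} (hθ : 0 ≤ θ)
    (p : OrientedPath n) :
    ∫ x, ∏ i ∈ outerSteps n r, Real.exp (-(θ * |x (OrientedPath.edge p i)|)) ∂(edgeLaw n)
      = (1 / (1 + θ)) ^ (2 * r) := by
  classical
  have h := integral_prod_exp_neg hθ ((outerSteps n r).image (OrientedPath.edge p))
  rw [Finset.card_image_of_injective _ (orientedPath_edge_injective p), card_outerSteps hr] at h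
  rw [← h]
  refine integral_congr_ae (Eventually.of_forall fun x => ?_)
  exact (Finset.prod_image (f := fun e => Real.exp (-(θ * |x e|)))
    fun i _ j _ h => orientedPath_edge_injective p h).symm

lemma ae_nonneg_edgeLaw : ∀ᵐ x ∂(edgeLaw n), ∀ e, 0 ≤ x e := by
  refine ae_all_iff.2 fun e => ?_
  exact (measurePreserving_eval (fun _ : Edge n => expMeasure 1) e).quasiMeasurePreserving.ae
    ae_nonneg_expMeasure

lemma prod_exp_neg_abs {ι : Type*} (s : Finset ι) (θ : ℝ) {x : ι → ℝ} (hx : ∀ i, 0 ≤ x i) :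
    ∏ i ∈ s, Real.exp (-(θ * |x i|)) = Real.exp (-(θ * ∑ i ∈ s, x i)) := by
  rw [← Real.exp_sum, Finset.sum_neg_distrib, ← Finset.mul_sum]
  simp only [abs_of_nonneg (hx _)]

/-- The total weight of the outer parts of the oriented paths. -/
noncomputable def outerPathMass (r : ℕ) (x : Edge n → ℝ) : ℝ :=
  ∑ p : OrientedPath n, ∏ i ∈ outerSteps n r, boltzmann x (OrientedPath.edge p i)

lemma integrable_outerPathMass (r : ℕ) : Integrable (outerPathMass (n := n) r) (edgeLaw n) :=
  integrable_comp_boltzmann (F := fun w => ∑ p : OrientedPath n, ∏ i ∈ outerSteps n r,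
    w (OrientedPath.edge p i)) (by fun_prop)

lemma integral_outerPathMass {r : ℕ} (hr : 2 * r ≤ n) :
    ∫ x, outerPathMass r x ∂(edgeLaw n) = n.factorial * (1 / (1 + n)) ^ (2 * r) := by
  unfold outerPathMass
  rw [integral_finsetSum]
  · have h : ∀ p : OrientedPath n, ∫ x, ∏ i ∈ outerSteps n r, boltzmann x (OrientedPath.edge p i)
        ∂(edgeLaw n) = (1 / (1 + n)) ^ (2 * r) := fun p =>
      integral_prod_outerSteps hr (Nat.cast_nonneg n) p
    simp only [h, Finset.sum_const, Finset.card_univ, nsmul_eq_mul, card_orientedPath]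
  · intro p _
    exact integrable_comp_boltzmann (F := fun w => ∏ i ∈ outerSteps n r,
      w (OrientedPath.edge p i)) (by fun_prop)

lemma factorial_eq_mul_descFactorial {k : ℕ} (hk : k ≤ n) :
    (n.factorial : ℝ) = (n - k).factorial * n.descFactorial k := by
  exact_mod_cast (Nat.factorial_mul_descFactorial hk).symm

/-- The difference has a sign by `sum_prod_outer_le`, so its `L¹` norm is a difference of means. The
first mean is at most `c`; the second is `c` times a descending factorial over `(n+1)^{2r}`, which
tends to `c`. -/
lemma integral_abs_sub_outerPathMass_le {r : ℕ} (hr : 2 * r ≤ n) {c : ℝ} (hc : 0 ≤ c) :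
    ∫ x, |totalMass r x * totalBackwardMass r x * c
      - c / (n - 2 * r).factorial * outerPathMass r x| ∂(edgeLaw n)
      ≤ c * (1 - ((n + 1 - 2 * r : ℕ) / (n + 1)) ^ (2 * r)) := by
  have hf : (0 : ℝ) < (n - 2 * r).factorial := by positivity
  have i1 := (integrable_totalMass_mul_totalBackwardMass (n := n) r).mul_const c
  have i2 := (integrable_outerPathMass (n := n) r).const_mul (c / (n - 2 * r).factorial)
  have h1 : ∀ x : Edge n → ℝ, |totalMass r x * totalBackwardMass r x * c
      - c / (n - 2 * r).factorial * outerPathMass r x|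
      = totalMass r x * totalBackwardMass r x * c
      - c / (n - 2 * r).factorial * outerPathMass r x := by
    intro x
    refine abs_of_nonneg (sub_nonneg.2 ?_)
    have h := mul_le_mul_of_nonneg_left (sum_prod_outer_le hr (boltzmann_nonneg x))
      (div_nonneg hc hf.le)
    refine h.trans_eq ?_
    rw [totalMass, totalBackwardMass]
    field_simp
  simp only [h1]
  rw [integral_sub i1 i2, integral_mul_const, integral_const_mul, integral_outerPathMass hr,
    factorial_eq_mul_descFactorial hr]
  have h2 := integral_totalMass_mul_totalBackwardMass_le_one hr
  have h3 : ((n + 1 - 2 * r : ℕ) : ℝ) ^ (2 * r) ≤ n.descFactorial (2 * r) := by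
    exact_mod_cast Nat.pow_sub_le_descFactorial n (2 * r)
  have h4 : c / (n - 2 * r).factorial * ((n - 2 * r).factorial * n.descFactorial (2 * r)
      * (1 / (1 + n)) ^ (2 * r)) = c * (n.descFactorial (2 * r) / (n + 1) ^ (2 * r)) := by
    rw [one_div, inv_pow, add_comm (1 : ℝ)]
    field_simp
  rw [h4, mul_comm _ c, ← mul_sub]
  refine mul_le_mul_of_nonneg_left ?_ hc
  rw [div_pow]
  gcongr

lemma integral_abs_conditionalCount_sub_le {r : ℕ} (hn : 4 * r + 4 ≤ n) {A : Set ℝ}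
    (hA : MeasurableSet A) {B : ℝ} (hB : A ⊆ Iic B) :
    ∫ x, |conditionalCount r A x
      - (∫ z in A, Real.exp (z - 1)) / (n - 2 * r).factorial * outerPathMass r x| ∂(edgeLaw n)
      ≤ Real.exp (B / 4) * (∫ z in Iic B, weightedDensityError r n z) * 4 ^ (2 * r) := by
  classical
  have hr : 2 * r ≤ n := by omega
  have hf : (0 : ℝ) < (n - 2 * r).factorial := by positivity
  set ε := Real.exp (B / 4) * ∫ z in Iic B, weightedDensityError r n z with hε
  have hε0 : 0 ≤ ε := mul_nonneg (Real.exp_pos _).le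
    (integral_nonneg fun z => weightedDensityError_nonneg r n z)
  set c := ∫ z in A, Real.exp (z - 1) with hc
  let D : OrientedPath n → (Edge n → ℝ) → ℝ := fun p x =>
    ∏ i ∈ outerSteps n r, Real.exp (-(n / 4 * |x (OrientedPath.edge p i)|))
  have hDi : ∀ p, Integrable (D p) (edgeLaw n) := by
    intro p
    refine .of_bound (Continuous.aestronglyMeasurable (by fun_prop)) 1
      (Eventually.of_forall fun x => ?_)
    rw [norm_prod]
    refine Finset.prod_le_one (fun _ _ => norm_nonneg _) fun i _ => ?_
    rw [Real.norm_eq_abs, Real.abs_exp]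
    exact Real.exp_le_one_iff.2 (neg_nonpos.2 (by positivity))
  have key : ∀ᵐ x ∂(edgeLaw n), |conditionalCount r A x
      - c / (n - 2 * r).factorial * outerPathMass r x|
      ≤ ∑ p : OrientedPath n, ε / (n - 2 * r).factorial * D p x := by
    filter_upwards [ae_nonneg_edgeLaw (n := n)] with x hx
    rw [conditionalCount, outerPathMass, Finset.mul_sum, ← Finset.sum_sub_distrib]
    refine (Finset.abs_sum_le_sum_abs _ _).trans (Finset.sum_le_sum fun p _ => ?_)
    rw [integral_windowIndicator_piecewise (by omega) hA]
    have e1 : ∏ i ∈ outerSteps n r, boltzmann x (OrientedPath.edge p i)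
        = Real.exp (-(n * ∑ i ∈ outerSteps n r, x (OrientedPath.edge p i))) :=
      prod_exp_neg_abs (x := fun i => x (OrientedPath.edge p i)) _ n fun i => hx _
    have e2 : D p x = Real.exp (-(n / 4 * ∑ i ∈ outerSteps n r, x (OrientedPath.edge p i))) :=
      prod_exp_neg_abs (x := fun i => x (OrientedPath.edge p i)) _ (n / 4 : ℝ) fun i => hx _
    have h := abs_factorial_mul_gammaHit_sub_le hn hA hB
      (Finset.sum_nonneg fun i (_ : i ∈ outerSteps n r) => hx (OrientedPath.edge p i))
    rw [← hε, ← hc] at h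
    rw [e1, e2, div_mul_eq_mul_div, div_mul_eq_mul_div, le_div_iff₀ hf]
    refine le_trans (le_of_eq ?_) h
    nth_rw 2 [← abs_of_pos hf]
    rw [← abs_mul, sub_mul, div_mul_cancel₀ _ hf.ne', mul_comm (gammaHit _ _ _ _)]
  calc _ ≤ ∫ x, ∑ p : OrientedPath n, ε / (n - 2 * r).factorial * D p x ∂(edgeLaw n) :=
        integral_mono_of_nonneg (Eventually.of_forall fun x => abs_nonneg _)
          (integrable_finsetSum _ fun p _ => (hDi p).const_mul _) key
    _ = n.factorial * (ε / (n - 2 * r).factorial * (1 / (1 + n / 4)) ^ (2 * r)) := by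
        rw [integral_finsetSum _ fun p _ => (hDi p).const_mul _]
        simp only [integral_const_mul, D,
          integral_prod_outerSteps hr (by positivity : (0 : ℝ) ≤ n / 4)]
        rw [Finset.sum_const, Finset.card_univ, nsmul_eq_mul, card_orientedPath]
    _ = ε * (n.descFactorial (2 * r) * (1 / (1 + n / 4)) ^ (2 * r)) := by
        rw [factorial_eq_mul_descFactorial hr]
        field_simp
    -- About `n^{2r}` choices of outer parts meet a mean of `(1 + n/4)^{-2r}`, and `n / (1 + n/4) ≤
    -- 4`.
    _ ≤ ε * 4 ^ (2 * r) := by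
        refine mul_le_mul_of_nonneg_left ?_ hε0
        have h1 : (n.descFactorial (2 * r) : ℝ) ≤ n ^ (2 * r) := by
          exact_mod_cast Nat.descFactorial_le_pow n (2 * r)
        have h2 : (n : ℝ) * (1 / (1 + n / 4)) ≤ 4 := by
          rw [mul_one_div, div_le_iff₀ (by positivity)]
          linarith
        calc _ ≤ (n : ℝ) ^ (2 * r) * (1 / (1 + n / 4)) ^ (2 * r) := by gcongr
          _ = (n * (1 / (1 + n / 4))) ^ (2 * r) := (mul_pow _ _ _).symm
          _ ≤ 4 ^ (2 * r) := by gcongr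

lemma abs_conditionalCount_le (r : ℕ) (A : Set ℝ) (x : Edge n → ℝ) :
    ‖conditionalCount r A x‖ ≤ Fintype.card (OrientedPath n) := by
  classical
  refine (norm_sum_le _ _).trans ((Finset.sum_le_card_nsmul _ _ 1 fun p _ => ?_).trans_eq ?_)
  · refine (norm_integral_le_of_norm_le_const
      (Eventually.of_forall fun y => norm_windowIndicator_le A p _)).trans_eq (by simp)
  · rw [nsmul_one, Finset.card_univ]

/-- The conditional expected number of paths is asymptotically the product of the total masses. -/
lemma tendsto_integral_abs_conditionalCount_sub (r : ℕ) {A : Set ℝ} (hA : MeasurableSet A) {B : ℝ}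
    (hB : A ⊆ Iic B) :
    Tendsto (fun n => ∫ x : Edge n → ℝ, |conditionalCount r A x - totalMass r x *
      totalBackwardMass r x * ∫ z in A, Real.exp (z - 1)| ∂(edgeLaw n)) atTop (𝓝 0) := by
  set c := ∫ z in A, Real.exp (z - 1) with hc
  have hc0 : 0 ≤ c := integral_nonneg fun z => (Real.exp_pos _).le
  have hlim1 : Tendsto (fun n : ℕ => Real.exp (B / 4)
      * (∫ z in Iic B, weightedDensityError r n z) * 4 ^ (2 * r)) atTop (𝓝 0) := by
    simpa using ((tendsto_integral_weightedDensityError r B).const_mul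
      (Real.exp (B / 4))).mul_const (4 ^ (2 * r))
  have hlim2 : Tendsto (fun n : ℕ => c * (1 - ((n + 1 - 2 * r : ℕ) / ((n : ℝ) + 1)) ^ (2 * r)))
      atTop (𝓝 0) := by
    have h1 : Tendsto (fun n : ℕ => 1 - (2 * r : ℝ) * (1 / ((n : ℝ) + 1))) atTop (𝓝 1) := by
      simpa using ((tendsto_one_div_add_atTop_nhds_zero_nat (𝕜 := ℝ)).const_mul
        (2 * r : ℝ)).const_sub 1
    have h2 : Tendsto (fun n : ℕ => ((n + 1 - 2 * r : ℕ) : ℝ) / ((n : ℝ) + 1)) atTop (𝓝 1) := by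
      refine h1.congr' ?_
      filter_upwards [eventually_ge_atTop (2 * r)] with n hn
      rw [Nat.cast_sub (by omega)]
      push_cast
      field_simp
    simpa using ((h2.pow (2 * r)).const_sub 1).const_mul c
  refine squeeze_zero' (Eventually.of_forall fun n => integral_nonneg fun x => abs_nonneg _) ?_
    (by simpa using hlim1.add hlim2)
  filter_upwards [eventually_ge_atTop (4 * r + 4)] with n hn
  have i1 : Integrable (conditionalCount (n := n) r A) (edgeLaw n) :=
    .of_bound (measurable_conditionalCount r hA).aestronglyMeasurable _
      (Eventually.of_forall fun x => abs_conditionalCount_le r A x)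
  have i2 := (integrable_outerPathMass (n := n) r).const_mul (c / (n - 2 * r).factorial)
  have i3 := (integrable_totalMass_mul_totalBackwardMass (n := n) r).mul_const c
  refine le_trans ?_ (add_le_add (integral_abs_conditionalCount_sub_le hn hA hB)
    (integral_abs_sub_outerPathMass_le (by omega : 2 * r ≤ n) hc0))
  have j1 : Integrable (fun x => |conditionalCount r A x
      - c / (n - 2 * r).factorial * outerPathMass r x|) (edgeLaw n) := (i1.sub i2).abs
  have j2 : Integrable (fun x => |totalMass r x * totalBackwardMass r x * c
      - c / (n - 2 * r).factorial * outerPathMass r x|) (edgeLaw n) := (i3.sub i2).abs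
  rw [← integral_add j1 j2]
  refine integral_mono (i1.sub i3).abs (j1.add j2) fun x => ?_
  rw [abs_sub_comm (totalMass r x * _ * _)]
  exact abs_sub_le _ _ _

lemma norm_exp_mul_I_sub_le (a b : ℝ) :
    ‖Complex.exp (a * Complex.I) - Complex.exp (b * Complex.I)‖ ≤ |a - b| := by
  have h := norm_exp_neg_sub_exp_neg_le (a := -(a * Complex.I)) (b := -(b * Complex.I))
    (by simp) (by simp)
  rw [neg_neg, neg_neg] at h
  refine h.trans_eq ?_
  rw [← neg_sub', ← sub_mul, norm_neg, norm_mul, Complex.norm_I, mul_one, ← Complex.ofReal_sub,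
    Complex.norm_real, Real.norm_eq_abs]

/-- Weak convergence of the conditional expected number of paths. -/
lemma tendsto_charFun_conditionalCount (r : ℕ) {A : Set ℝ} (hA : MeasurableSet A) {B : ℝ}
    (hB : A ⊆ Iic B) {μ : ProbabilityMeasure ℝ} (hμ : Tendsto (massLaw r) atTop (𝓝 μ)) (t : ℝ) :
    Tendsto (fun n => charFun ((edgeLaw n).map (conditionalCount r A)) t) atTop
      (𝓝 (charFun (scaledProductLaw (∫ z in A, Real.exp (z - 1)) μ : Measure ℝ) t)) := by
  set c := ∫ z in A, Real.exp (z - 1) with hc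
  have h1 := tendsto_charFun_of_tendsto
    (((continuous_scaledProductLaw c).tendsto μ).comp hμ) t
  -- Both laws are images of the same edge weights, so `L¹` closeness bounds the distance of the
  -- characteristic functions by `|t|` times the `L¹` distance.
  have h2 : Tendsto (fun n => charFun ((edgeLaw n).map (conditionalCount r A)) t
      - charFun (scaledProductLaw c (massLaw r n) : Measure ℝ) t) atTop (𝓝 0) := by
    rw [tendsto_zero_iff_norm_tendsto_zero]
    refine squeeze_zero' (Eventually.of_forall fun _ => norm_nonneg _) ?_
      (by simpa using (tendsto_integral_abs_conditionalCount_sub r hA hB).const_mul |t|)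
    filter_upwards [eventually_ge_atTop (2 * r)] with n hn
    have m1 := measurable_conditionalCount (n := n) r hA
    have m2 : Measurable fun x : Edge n → ℝ => totalMass r x * totalBackwardMass r x * c :=
      ((continuous_totalMass r).measurable.mul
        (continuous_totalBackwardMass r).measurable).mul_const c
    rw [← map_totalMass_mul_totalBackwardMass hn, charFun_map_edgeLaw m1, charFun_map_edgeLaw m2,
      ← integral_sub, ← integral_const_mul]
    · refine norm_integral_le_of_norm_le (Integrable.const_mul ?_ _) (Eventually.of_forall fun x => ?_)
      · refine (Integrable.sub ?_ ?_).abs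
        · exact .of_bound m1.aestronglyMeasurable _
            (Eventually.of_forall fun x => abs_conditionalCount_le r A x)
        · exact (integrable_totalMass_mul_totalBackwardMass r).mul_const c
      · refine (norm_exp_mul_I_sub_le _ _).trans_eq ?_
        rw [← mul_sub, abs_mul]
    · exact .of_bound (Measurable.aestronglyMeasurable (by fun_prop)) 1
        (Eventually.of_forall fun x => (Complex.norm_exp_ofReal_mul_I _).le)
    · exact .of_bound (Measurable.aestronglyMeasurable (by fun_prop)) 1
        (Eventually.of_forall fun x => (Complex.norm_exp_ofReal_mul_I _).le)
  simpa using h2.add h1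

end Comparison

end HypercubeFPP

/-! ### The main theorem. -/

theorem corollary4
    -- for every dimension `n`, independent standard exponential weights on the edges
    {Ω : ℕ → Type*} [∀ n, MeasurableSpace (Ω n)]
    (P : ∀ n, Measure (Ω n)) [∀ n, IsProbabilityMeasure (P n)]
    (ξ : ∀ n, HypercubeFPP.Edge n → Ω n → ℝ)
    (hξ_meas : ∀ n e, Measurable (ξ n e))
    (hξ_law : ∀ n e, HasLaw (ξ n e) (expMeasure 1) (P n))
    (hξ_indep : ∀ n, iIndepFun (ξ n) (P n))
    -- a random variable distributed like the product of two independent standard exponentials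
    {Ω' : Type*} [MeasurableSpace Ω'] (P' : Measure Ω') [IsProbabilityMeasure P']
    (Z : Ω' → ℝ) (hZ : HasLaw Z HypercubeFPP.expProductLaw P')
    -- a finite union of intervals, each of them bounded above
    (k : ℕ) (J : Fin k → Set ℝ) (hJ : ∀ i, (J i).OrdConnected) (hJ_bdd : ∀ i, BddAbove (J i))
    (A : Set ℝ) (hA : A = ⋃ i, J i) :
    -- the weak limits `ν r` as `n → ∞` exist, and they converge weakly as `r → ∞`
    ∃ ν : ℕ → ProbabilityMeasure ℝ,
      (∀ r : ℕ, TendstoInDistribution (fun n => HypercubeFPP.poissonParameter (P n) (ξ n) r A) atTop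
        (id : ℝ → ℝ) P (ν r : Measure ℝ)) ∧
      TendstoInDistribution (fun _ : ℕ => (id : ℝ → ℝ)) atTop
        (fun ω => Z ω * ∫ x in A, Real.exp (x - 1)) (fun r => (ν r : Measure ℝ)) P' := by
  have hAm : MeasurableSet A := by
    rw [hA]
    exact MeasurableSet.iUnion fun i => (hJ i).measurableSet
  obtain ⟨B, hB⟩ : ∃ B, A ⊆ Set.Iic B := by
    choose b hb using hJ_bdd
    obtain ⟨B, hB⟩ := (Set.finite_range b).bddAbove
    refine ⟨B, ?_⟩
    rw [hA]
    exact Set.iUnion_subset fun i x hx => (hb i hx).trans (hB ⟨i, rfl⟩)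
  have hlaw : ∀ n, (P n).map (fun ω e => ξ n e ω) = HypercubeFPP.edgeLaw n := fun n => by
    rw [(hξ_indep n).map_fun_eq_pi_map fun e => (hξ_meas n e).aemeasurable]
    simp only [(hξ_law n _).map_eq]
  obtain ⟨μ, hμ, hμ'⟩ := HypercubeFPP.exists_massLaw_limit
  set c := ∫ x in A, Real.exp (x - 1) with hc
  -- The limit `ν r` is the law of `c` times the product of two independent copies of the limiting
  -- mass of generation `r`. The limit in `r` is then weak continuity of this construction at the
  -- standard exponential law.
  refine ⟨fun r => HypercubeFPP.scaledProductLaw c (μ r), fun r => ?_, ?_⟩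
  · have hae := fun n => HypercubeFPP.poissonParameter_ae_eq (P n) (hξ_meas n) (hlaw n) r hAm
    have hXm : ∀ n, Measurable fun ω e => ξ n e ω := fun n => measurable_pi_lambda _ (hξ_meas n)
    have hcm := fun n => HypercubeFPP.measurable_conditionalCount (n := n) r hAm
    refine ⟨fun n => ((hcm n).comp (hXm n)).aemeasurable.congr (hae n).symm, aemeasurable_id, ?_⟩
    refine ProbabilityMeasure.tendsto_of_tendsto_charFun fun t => ?_
    have h := HypercubeFPP.tendsto_charFun_conditionalCount r hAm hB (hμ r) t
    simp only [ProbabilityMeasure.coe_mk, Measure.map_id]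
    refine h.congr fun n => ?_
    rw [Measure.map_congr (hae n), ← hlaw n, Measure.map_map (hcm n) (hXm n)]
    rfl
  · refine ⟨fun r => aemeasurable_id, hZ.aemeasurable.mul_const c, ?_⟩
    have h := ((HypercubeFPP.continuous_scaledProductLaw c).tendsto _).comp hμ'
    have e : P'.map (fun ω => Z ω * c) = (HypercubeFPP.scaledProductLaw c
        ⟨expMeasure 1, inferInstance⟩ : Measure ℝ) := by
      have e1 : (HypercubeFPP.scaledProductLaw c ⟨expMeasure 1, inferInstance⟩ : Measure ℝ)
        = ((expMeasure 1).prod (expMeasure 1)).map fun q : ℝ × ℝ => q.1 * q.2 * c := rfl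
      have e2 : P'.map (fun ω => Z ω * c) = (P'.map Z).map fun z => z * c := by
        rw [AEMeasurable.map_map_of_aemeasurable (by fun_prop) hZ.aemeasurable]
        rfl
      rw [e1, e2, hZ.map_eq, HypercubeFPP.expProductLaw,
        Measure.map_map (by fun_prop) (by fun_prop)]
      rfl
    simp only [Measure.map_id, e]
    exact h
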